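/- Let $N\ge 4$, $0<\mu<N$, $2^*_\mu=\frac{2N-\mu}{N-2}$, and let $\Omega\subset\mathbb R^N$ be a bounded domain with smooth boundary. For $u\in H^1(\Omega)$ put $$\|u\|_{0,\Omega}^{2\cdot 2^*_\mu}=\iint_{\Omega\times\Omega}\frac{|u(x)|^{2^*_\mu}|u(y)|^{2^*_\mu}}{|x-y|^\mu}\,dx\,dy,$$ and let $$S_H=\inf\Big\{\int_\Omega|\nabla u|^2\,dx:\ u\in H^1_0(\Omega),\ \|u\|_{0,\Omega}^{2\cdot 2^*_\mu}=1\Big\},\qquad S_H(a)=\inf_{u\in H^1(\Omega)\setminus\{0\}}\frac{\int_\Omega|\nabla u|^2\,dx-\int_\Omega a\,u^2\,dx}{\|u\|_{0,\Omega}^2}$$ for a bounded measurable function $a$ on $\Omega$. For $k\in\mathbb R$, the boundary $\partial\Omega$ is called flat of order $k$ at $x_0\in\partial\Omega$ if, after a translation and a rotation that take $x_0$ to $0$, there are $R>0$ and a smooth function $\rho:\{x'\in\mathbb R^{N-1}:|x'|<R\}\to\mathbb R$ with $\rho(0)=0$, $\nabla\rho(0)=0$, $$\Omega\cap B_R(0)=\{(x',x_N)\in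 B_R(0): x_N>\rho(x')\},\qquad \partial\Omega\cap B_R(0)=\{(x',x_N)\in B_R(0): x_N=\rho(x')\},$$ and $\rho(x')=O(|x'|^k)$ as $x'\to0$. **Lemma.** Let $\alpha\in C(\overline\Omega)$, and suppose that there is a point $x_0\in\partial\Omega$ such that $\alpha(x_0)>0$ and $\partial\Omega$ is flat at $x_0$ of some order $k>\frac{6N-\mu}{2N-\mu}$. Then for every $\lambda>0$ $$S_H(\lambda\alpha)<\frac{S_H}{2^{(2^*_\mu-2)/2^*_\mu}}.$$ -/

import Mathlib

open MeasureTheory Metric Filter Topology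
open scoped ENNReal ContDiff Gradient

namespace NeumannChoquard

/-- The Euclidean space `ℝ^N`. -/
abbrev Space (N : ℕ) : Type := EuclideanSpace ℝ (Fin N)

/-- The Euclidean space `ℝ^(N-1) × ℝ`, with points written as `(x', x_N)`. -/
abbrev SplitSpace (N : ℕ) : Type := WithLp 2 (EuclideanSpace ℝ (Fin (N - 1)) × ℝ)

/-! ### Domains with smooth boundary and flatness of the boundary -/

/-- After the translation taking `x₀` to `0` and the linear isometry `T`, the set `Ω` is, inside
the ball of radius `R` about `0`, the region strictly above the graph `x_N = ρ(x')` of a smooth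
function `ρ` with `ρ(0) = 0` and `∇ρ(0) = 0`, and the boundary of `Ω` is this graph. -/
structure IsBoundaryGraph {N : ℕ} (Ω : Set (Space N)) (x₀ : Space N)
    (T : Space N ≃ₗᵢ[ℝ] SplitSpace N) (ρ : EuclideanSpace ℝ (Fin (N - 1)) → ℝ) (R : ℝ) :
    Prop where
  pos : 0 < R
  smooth : ContDiffOn ℝ ∞ ρ (ball 0 R)
  map_zero : ρ 0 = 0
  fderiv_zero : fderiv ℝ ρ 0 = 0
  mem_iff : ∀ x ∈ ball x₀ R, x ∈ Ω ↔ ρ (T (x - x₀)).fst < (T (x - x₀)).snd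
  mem_frontier_iff : ∀ x ∈ ball x₀ R, x ∈ frontier Ω ↔ (T (x - x₀)).snd = ρ (T (x - x₀)).fst

/-- A bounded domain (bounded, open, connected and non-empty set) with smooth boundary. -/
structure IsBoundedSmoothDomain {N : ℕ} (Ω : Set (Space N)) : Prop where
  isOpen : IsOpen Ω
  isConnected : IsConnected Ω
  isBounded : Bornology.IsBounded Ω
  smooth_boundary : ∀ x₀ ∈ frontier Ω, ∃ T ρ R, IsBoundaryGraph Ω x₀ T ρ R

/-- The boundary of `Ω` is flat of order `k` at `x₀`: near `x₀` it is a graph `x_N = ρ(x')` as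
above, with `ρ(x') = O(|x'|^k)` as `x' → 0`. -/
def IsFlatOfOrder {N : ℕ} (Ω : Set (Space N)) (x₀ : Space N) (k : ℝ) : Prop :=
  ∃ T ρ R, IsBoundaryGraph Ω x₀ T ρ R ∧ ρ =O[𝓝 0] fun x' => ‖x'‖ ^ k

/-! ### Sobolev spaces -/

/-- Test functions: elements of `C_c^∞(Ω)`, as functions on the whole space. -/
structure IsTestFunction {N : ℕ} (Ω : Set (Space N)) (φ : Space N → ℝ) : Prop where
  contDiff : ContDiff ℝ ∞ φ
  hasCompactSupport : HasCompactSupport φ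
  tsupport_subset : tsupport φ ⊆ Ω

/-- `u ∈ H¹(Ω)` with weak gradient `G = ∇u`: both are square integrable over `Ω` and
`∫_Ω u ∂_v φ = - ∫_Ω (G · v) φ` for all test functions `φ` and directions `v`. The values of
`u` and `G` outside `Ω` are irrelevant, and `G` is determined by `u` almost everywhere in `Ω`. -/
structure IsH1 {N : ℕ} (Ω : Set (Space N)) (u : Space N → ℝ) (G : Space N → Space N) :
    Prop where
  memLp : MemLp u 2 (volume.restrict Ω)
  memLp_grad : MemLp G 2 (volume.restrict Ω)
  weak_grad : ∀ φ, IsTestFunction Ω φ → ∀ v : Space N,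
    ∫ x in Ω, u x * fderiv ℝ φ x v = - ∫ x in Ω, inner ℝ (G x) v * φ x

/-- `u ∈ H¹₀(Ω)` with weak gradient `G = ∇u`: the pair `(u, G)` is the limit in `H¹(Ω)` of test
functions and their gradients. -/
structure IsH10 {N : ℕ} (Ω : Set (Space N)) (u : Space N → ℝ) (G : Space N → Space N) : Prop
    extends IsH1 Ω u G where
  approx : ∃ φ : ℕ → Space N → ℝ, (∀ n, IsTestFunction Ω (φ n)) ∧
    Tendsto (fun n => eLpNorm (fun x => u x - φ n x) 2 (volume.restrict Ω)) atTop (𝓝 0) ∧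
    Tendsto (fun n => eLpNorm (fun x => G x - ∇ (φ n) x) 2 (volume.restrict Ω)) atTop (𝓝 0)

/-! ### The Choquard term and the two Sobolev constants -/

/-- The critical exponent `2*_μ = (2N - μ)/(N - 2)`. -/
noncomputable def critExp (N : ℕ) (μ : ℝ) : ℝ := (2 * N - μ) / (N - 2)

/-- `‖u‖_{0,Ω}^{2·2*_μ} = ∬_{Ω×Ω} |u(x)|^{2*_μ} |u(y)|^{2*_μ} / |x-y|^μ dx dy`. -/
noncomputable def choquardEnergy {N : ℕ} (μ : ℝ) (Ω : Set (Space N)) (u : Space N → ℝ) : ℝ≥0∞ :=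
  ∫⁻ x in Ω, ∫⁻ y in Ω,
    ENNReal.ofReal (|u x| ^ critExp N μ * |u y| ^ critExp N μ / ‖x - y‖ ^ μ)

/-- `‖u‖_{0,Ω}^2`. On a bounded smooth domain the double integral is finite for every
`u ∈ H¹(Ω)`, by the Hardy–Littlewood–Sobolev inequality and the Sobolev embedding. -/
noncomputable def choquardNormSq {N : ℕ} (μ : ℝ) (Ω : Set (Space N)) (u : Space N → ℝ) : ℝ :=
  (choquardEnergy μ Ω u).toReal ^ (1 / critExp N μ)

/-- `S_H`, the best constant for `H¹₀(Ω)` with respect to `‖·‖_{0,Ω}`: the infimum of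
`∫_Ω |∇u|²` over `u ∈ H¹₀(Ω)` with `‖u‖_{0,Ω}^{2·2*_μ} = 1`. -/
noncomputable def bestConstant {N : ℕ} (μ : ℝ) (Ω : Set (Space N)) : ℝ :=
  sInf {s | ∃ u G, IsH10 Ω u G ∧ choquardEnergy μ Ω u = 1 ∧ s = ∫ x in Ω, ‖G x‖ ^ 2}

/-- The quotient `Q(u) = (∫_Ω |∇u|² - ∫_Ω a u²) / ‖u‖_{0,Ω}^2`, where `G = ∇u`. -/
noncomputable def sobolevQuotient {N : ℕ} (μ : ℝ) (Ω : Set (Space N)) (a : Space N → ℝ)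
    (u : Space N → ℝ) (G : Space N → Space N) : ℝ :=
  ((∫ x in Ω, ‖G x‖ ^ 2) - ∫ x in Ω, a x * u x ^ 2) / choquardNormSq μ Ω u

/-- `S_H(a) = S_H(∅, a, 0)`: the infimum, in the extended reals, of `Q(u)` over
`u ∈ H¹(Ω) \ {0}`. -/
noncomputable def neumannConstant {N : ℕ} (μ : ℝ) (Ω : Set (Space N)) (a : Space N → ℝ) : EReal :=
  sInf {s | ∃ u G, IsH1 Ω u G ∧ ¬ (∀ᵐ x ∂volume.restrict Ω, u x = 0) ∧
    s = (sobolevQuotient μ Ω a u G : EReal)}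

end NeumannChoquard

/-!
Write `p = 2*_μ`, `E` for the Dirichlet energy and `D` for the Choquard energy, both on the whole
space, and `E_H`, `D_H` for the same energies over a half-space `H`.

*Concentration.* Rescaling a smooth function `φ` with compact support about a boundary point turns
the domain into a half-space in the limit, since the boundary is differentiable, and makes the
zeroth order term negligible. So the Neumann constant is at most `E_H / D_H ^ (1 / p)`
(`neumannConstant_le_halfSpace`), for every `φ` and every half-space `H`.

*Gap.* Every `φ` admits a half-space `H` with `E_H ≤ E / 2` and `4 D_H ≥ θ D`, where `θ > 1` depends
only on `N` and `μ` (`exists_halfSpace_gap`). Such an `H` has quotient at most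
`θ ^ (-1 / p) 2 ^ (2 / p - 1) E / D ^ (1 / p)`. Hence a Neumann constant that is at least
`S_H / 2 ^ (1 - 2 / p)` would give `E / D ^ (1 / p) ≥ θ ^ (1 / p) S_H` for all test functions, and
then, by Fatou's lemma, `S_H ≥ θ ^ (1 / p) S_H`. This contradicts `S_H > 0`, which follows from the
Sobolev inequality and the Hardy–Littlewood–Sobolev inequality (`exists_hls`). No knowledge of
minimizers is needed.

For the gap, the kernel `|x - y| ^ (-μ)` is written as an integral of products of indicator
functions of balls (`exists_rieszEnergy_eq`), so that the energy of a measure `ν` is the integral of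
`ν(B) ^ 2` over all balls `B`, with a scale-invariant weight. For the two sides of a hyperplane, the
sum of the energies exceeds twice the mutual energy by at least the contribution of the balls that
avoid the hyperplane. A ball that meets all coordinate hyperplanes through a point `o` has radius
comparable to the distance from its centre to `o`, at least; a Hardy inequality over dyadic scales
bounds the contribution of these balls by that of the others
(`exists_ballEnergy_le_sum_sideBallEnergy`). Thus one of the `N` hyperplanes through `o` has an
energy defect of a fixed proportion of `D` (`exists_half_energy_gap`). By the intermediate value
theorem, `o` can be chosen such that each of these hyperplanes splits the measure into sides of
equal energy.
-/

namespace NeumannChoquard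

open Set
open scoped Pointwise

/-! ### Scaling of integrals and the ball representation of the Riesz kernel -/

theorem lintegral_comp_smul_eq {E : Type*} [NormedAddCommGroup E] [NormedSpace ℝ E]
    [MeasurableSpace E] [BorelSpace E] [FiniteDimensional ℝ E] (ν : Measure E)
    [ν.IsAddHaarMeasure] (F : E → ℝ≥0∞) {c : ℝ} (hc : 0 < c) :
    ∫⁻ x, F (c • x) ∂ν = ENNReal.ofReal (c ^ (-(Module.finrank ℝ E : ℝ))) * ∫⁻ x, F x ∂ν := by
  have h := Measure.map_addHaar_smul ν hc.ne'
  have h2 : ∫⁻ x, F x ∂(Measure.map (c • ·) ν) = ∫⁻ x, F (c • x) ∂ν :=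
    lintegral_map_equiv F (Homeomorph.smulOfNeZero c hc.ne').toMeasurableEquiv
  rw [← h2, h, lintegral_smul_measure, smul_eq_mul]
  congr 2
  rw [abs_of_pos (by positivity), Real.rpow_neg hc.le, Real.rpow_natCast]

theorem lintegral_Ioi_rpow_mul_comp_mul (s : ℝ) (G : ℝ → ℝ≥0∞) {c : ℝ} (hc : 0 < c) :
    ∫⁻ R in Ioi (0 : ℝ), ENNReal.ofReal (R ^ (-(s + 1))) * G (c * R) =
      ENNReal.ofReal (c ^ s) *
        ∫⁻ R in Ioi (0 : ℝ), ENNReal.ofReal (R ^ (-(s + 1))) * G R := by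
  have h := lintegral_comp_smul_eq (volume : Measure ℝ)
    ((Ioi (0 : ℝ)).indicator fun R => ENNReal.ofReal (R ^ (-(s + 1))) * G R) hc
  rw [lintegral_indicator measurableSet_Ioi] at h
  have h3 : ∀ x : ℝ, (Ioi (0 : ℝ)).indicator
      (fun R => ENNReal.ofReal (R ^ (-(s + 1))) * G R) (c • x) =
      ENNReal.ofReal (c ^ (-(s + 1))) * (Ioi (0 : ℝ)).indicator
        (fun R => ENNReal.ofReal (R ^ (-(s + 1))) * G (c * R)) x := by
    intro x
    by_cases hx : 0 < x
    · rw [indicator_of_mem (by simpa using mul_pos hc hx), indicator_of_mem (by simpa using hx),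
        smul_eq_mul, Real.mul_rpow hc.le hx.le, ENNReal.ofReal_mul (by positivity), mul_assoc]
    · rw [indicator_of_notMem, indicator_of_notMem (by simpa using hx), mul_zero]
      simp only [smul_eq_mul, mem_Ioi, not_lt] at *
      exact mul_nonpos_of_nonneg_of_nonpos hc.le hx
  simp_rw [h3] at h
  rw [lintegral_const_mul' _ _ ENNReal.ofReal_ne_top, lintegral_indicator measurableSet_Ioi,
    Module.finrank_self, Nat.cast_one] at h
  have h4 : ENNReal.ofReal (c ^ (s + 1)) * ENNReal.ofReal (c ^ (-(s + 1))) = 1 := by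
    rw [← ENNReal.ofReal_mul (by positivity), ← Real.rpow_add hc]; simp
  have h5 : ENNReal.ofReal (c ^ (s + 1)) * ENNReal.ofReal (c ^ (-1 : ℝ))
      = ENNReal.ofReal (c ^ s) := by
    rw [← ENNReal.ofReal_mul (by positivity), ← Real.rpow_add hc]; congr 2; ring
  rw [← h5, mul_assoc, ← h, ← mul_assoc, h4, one_mul]

/-- The mass that the scale-invariant measure `R ^ (-(μ + N + 1)) dz dR` on pairs (centre, radius)
gives to the balls `B(z, R)` containing both `x` and `y`. -/
noncomputable def ballKernel {N : ℕ} (μ : ℝ) (x y : Space N) : ℝ≥0∞ :=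
  ∫⁻ R in Ioi (0 : ℝ), ENNReal.ofReal (R ^ (-(μ + N + 1))) * volume (ball x R ∩ ball y R)

theorem ballKernel_sub {N : ℕ} (μ : ℝ) (x y : Space N) :
    ballKernel μ x y = ballKernel μ (x - y) 0 := by
  unfold ballKernel
  congr 1; ext R; congr 1
  rw [← measure_preimage_add_right volume y (ball x R ∩ ball y R), preimage_inter,
    preimage_add_right_ball, preimage_add_right_ball, sub_self]

theorem ballKernel_linearIsometryEquiv {N : ℕ} (μ : ℝ) (L : Space N ≃ₗᵢ[ℝ] Space N)
    (x : Space N) : ballKernel μ (L x) 0 = ballKernel μ x 0 := by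
  unfold ballKernel
  congr 1; ext R; congr 1
  rw [← L.measurePreserving.measure_preimage
    (measurableSet_ball.inter measurableSet_ball).nullMeasurableSet, preimage_inter]
  simp

theorem ballKernel_smul {N : ℕ} (μ : ℝ) (x : Space N) {d : ℝ} (hd : 0 < d) :
    ballKernel μ (d • x) 0 = ENNReal.ofReal (d ^ (-μ)) * ballKernel μ x 0 := by
  unfold ballKernel
  have hv : ∀ R : ℝ, volume (ball (d • x) (d * R) ∩ ball (0 : Space N) (d * R)) =
      ENNReal.ofReal (d ^ (N : ℝ)) * volume (ball x R ∩ ball (0 : Space N) R) := by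
    intro R
    have h0 : ball (0 : Space N) (d * R) = d • ball (0 : Space N) R := by
      rw [_root_.smul_ball hd.ne', smul_zero, Real.norm_of_nonneg hd.le]
    have h1 : ball (d • x) (d * R) = d • ball x R := by
      rw [_root_.smul_ball hd.ne', Real.norm_of_nonneg hd.le]
    rw [h0, h1, ← smul_set_inter₀ hd.ne', Measure.addHaar_smul]
    congr 2
    simp [abs_of_pos hd]
  have h := lintegral_Ioi_rpow_mul_comp_mul (μ + N)
    (fun R => volume (ball (d • x) R ∩ ball (0 : Space N) R)) hd
  simp_rw [hv, ← mul_assoc, mul_comm _ (ENNReal.ofReal (d ^ (N : ℝ))), mul_assoc] at h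
  rw [lintegral_const_mul' _ _ ENNReal.ofReal_ne_top] at h
  have h4 : ENNReal.ofReal (d ^ (-(μ + N))) * ENNReal.ofReal (d ^ (μ + N)) = 1 := by
    rw [← ENNReal.ofReal_mul (by positivity), ← Real.rpow_add hd]; simp
  have h5 : ENNReal.ofReal (d ^ (-(μ + N))) * ENNReal.ofReal (d ^ (N : ℝ))
      = ENNReal.ofReal (d ^ (-μ)) := by
    rw [← ENNReal.ofReal_mul (by positivity), ← Real.rpow_add hd]; congr 2; ring
  rw [← h5, mul_assoc, h, ← mul_assoc, h4, one_mul]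

/-- Up to a constant, the Riesz kernel `|x - y| ^ (-μ)` is an integral of products of indicator
functions of balls. -/
theorem exists_ballKernel_eq {N : ℕ} (hN : 0 < N) {μ : ℝ} (hμ : 0 < μ) :
    ∃ c : ℝ≥0∞, c ≠ 0 ∧ c ≠ ⊤ ∧ ∀ x y : Space N, x ≠ y →
      ballKernel μ x y = c * ENNReal.ofReal (‖x - y‖ ^ (-μ)) := by
  set e : Space N := EuclideanSpace.single ⟨0, hN⟩ 1 with he
  have hen : ‖e‖ = 1 := by simp [he]
  have : Nonempty (Fin N) := ⟨⟨0, hN⟩⟩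
  refine ⟨ballKernel μ e 0, ?_, ?_, ?_⟩
  · have h : ENNReal.ofReal ((3 : ℝ) ^ (-(μ + N + 1))) * volume (ball (0 : Space N) 1)
        ≤ ballKernel μ e 0 := by
      calc _ = ∫⁻ R in Ioo (2 : ℝ) 3,
            ENNReal.ofReal ((3 : ℝ) ^ (-(μ + N + 1))) * volume (ball (0 : Space N) 1) := by
            rw [setLIntegral_const, Real.volume_Ioo]; norm_num
        _ ≤ ∫⁻ R in Ioo (2 : ℝ) 3, ENNReal.ofReal (R ^ (-(μ + N + 1))) *
              volume (ball e R ∩ ball (0 : Space N) R) := by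
            refine setLIntegral_mono' measurableSet_Ioo fun R hR => ?_
            gcongr ?_ * volume ?_
            · refine ENNReal.ofReal_le_ofReal (Real.rpow_le_rpow_of_nonpos (by linarith [hR.1])
                hR.2.le ?_)
              have : (0 : ℝ) ≤ N := Nat.cast_nonneg _
              linarith
            · refine subset_inter (ball_subset ?_) (ball_subset_ball (by linarith [hR.1]))
              rw [dist_zero_left, hen]; linarith [hR.1]
        _ ≤ _ := lintegral_mono_set fun R hR => by
            simp only [mem_Ioi]; linarith [hR.1]
    intro h0
    rw [h0, nonpos_iff_eq_zero, mul_eq_zero] at h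
    rcases h with h | h
    · rw [ENNReal.ofReal_eq_zero] at h
      have : (0 : ℝ) < 3 ^ (-(μ + N + 1)) := by positivity
      linarith
    · exact (measure_ball_pos volume (0 : Space N) one_pos).ne' h
  · have h : ballKernel μ e 0 ≤ volume (ball (0 : Space N) 1) *
        ∫⁻ R in Ioi (1 / 2 : ℝ), ENNReal.ofReal (R ^ (-(μ + 1))) := by
      unfold ballKernel
      rw [← lintegral_const_mul' _ _ measure_ball_lt_top.ne,
        ← lintegral_indicator measurableSet_Ioi, ← lintegral_indicator measurableSet_Ioi]
      refine lintegral_mono fun R => ?_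
      by_cases hR : 0 < R
      · rw [indicator_of_mem (by simpa using hR)]
        by_cases hR2 : 1 / 2 < R
        · rw [indicator_of_mem (by simpa using hR2)]
          calc _ ≤ ENNReal.ofReal (R ^ (-(μ + N + 1))) * volume (ball (0 : Space N) R) := by
                gcongr; exact inter_subset_right
            _ = _ := by
                rw [Measure.addHaar_ball volume _ hR.le, ← mul_assoc,
                  ← ENNReal.ofReal_mul (by positivity), mul_comm]
                congr 2
                rw [finrank_euclideanSpace, Fintype.card_fin, ← Real.rpow_natCast,
                  ← Real.rpow_add hR]
                congr 1; ring
        · rw [(ball_disjoint_ball (by rw [dist_zero_right, hen]; linarith)).inter_eq]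
          simp
      · rw [indicator_of_notMem (by simpa using hR)]; exact zero_le
    refine (lt_of_le_of_lt h (ENNReal.mul_lt_top measure_ball_lt_top ?_)).ne
    have := integrableOn_Ioi_rpow_of_lt (show -(μ + 1) < -1 by linarith)
      (show (0 : ℝ) < 1 / 2 by norm_num)
    refine lt_of_le_of_lt (lintegral_mono fun R => ?_) this.2
    exact Real.ofReal_le_enorm _
  · intro x y hxy
    have hd : 0 < ‖x - y‖ := norm_pos_iff.mpr (sub_ne_zero.mpr hxy)
    set u := ‖x - y‖⁻¹ • (x - y) with hu
    have hun : ‖u‖ = 1 := by rw [hu, norm_smul, norm_inv, norm_norm, inv_mul_cancel₀ hd.ne']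
    have h1 : x - y = ‖x - y‖ • u := by rw [hu, smul_smul, mul_inv_cancel₀ hd.ne', one_smul]
    have h2 := Submodule.reflection_sub (show ‖e‖ = ‖u‖ by rw [hen, hun])
    rw [ballKernel_sub, h1, ballKernel_smul _ _ hd, ← h2, ballKernel_linearIsometryEquiv, mul_comm,
      h2, ← h1]

/-! ### Riesz energies of measures -/

/-- The mutual energy `∬ |x - y| ^ (-μ) dν₁(x) dν₂(y)`; the kernel has the junk value `0` on the
diagonal, so this is used only for measures without atoms. -/
noncomputable def rieszEnergy {N : ℕ} (μ : ℝ) (ν₁ ν₂ : Measure (Space N)) : ℝ≥0∞ :=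
  ∫⁻ x, ∫⁻ y, ENNReal.ofReal (‖x - y‖ ^ (-μ)) ∂ν₂ ∂ν₁

theorem measurable_measure_ball {N : ℕ} (ν : Measure (Space N)) [SFinite ν] :
    Measurable fun q : ℝ × Space N => ν (ball q.2 q.1) := by
  have : MeasurableSet {q : (ℝ × Space N) × Space N | dist q.2 q.1.2 < q.1.1} :=
    (isOpen_lt (by fun_prop) (by fun_prop)).measurableSet
  exact measurable_measure_prodMk_left this

theorem exists_rieszEnergy_eq {N : ℕ} (hN : 0 < N) {μ : ℝ} (hμ : 0 < μ) :
    ∃ c : ℝ≥0∞, c ≠ 0 ∧ c ≠ ⊤ ∧ ∀ (ν₁ ν₂ : Measure (Space N)) [SFinite ν₁] [SFinite ν₂]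
      [NullSingletonClass ν₂], c * rieszEnergy μ ν₁ ν₂ =
        ∫⁻ R in Ioi (0 : ℝ), ENNReal.ofReal (R ^ (-(μ + N + 1))) *
          ∫⁻ z, ν₁ (ball z R) * ν₂ (ball z R) := by
  obtain ⟨c, hc0, hct, hc⟩ := exists_ballKernel_eq hN hμ
  refine ⟨c, hc0, hct, fun ν₁ ν₂ _ _ _ => ?_⟩
  set w : ℝ → ℝ≥0∞ := fun R => ENNReal.ofReal (R ^ (-(μ + N + 1))) with hw
  have hwm : Measurable w := by fun_prop
  set J : ℝ × Space N × Space N → ℝ≥0∞ := indicator {q | dist q.2.2 q.2.1 < q.1} 1 with hJ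
  have hJm : Measurable J :=
    measurable_one.indicator (isOpen_lt (by fun_prop) (by fun_prop)).measurableSet
  have hJball : ∀ (ν : Measure (Space N)) (R : ℝ) (z : Space N),
      ∫⁻ x, J (R, z, x) ∂ν = ν (ball z R) := by
    intro ν R z
    rw [← lintegral_indicator_one measurableSet_ball]
    rfl
  have hJvol : ∀ (R : ℝ) (x y : Space N),
      volume (ball x R ∩ ball y R) = ∫⁻ z, J (R, z, x) * J (R, z, y) := by
    intro R x y
    rw [← lintegral_indicator_one (measurableSet_ball.inter measurableSet_ball)]
    congr 1; ext z
    simp only [hJ, indicator_apply, mem_ofPred_eq, dist_comm x,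
      dist_comm y, Pi.one_apply]
    split_ifs <;> simp_all
  have hJz : ∀ (R : ℝ) (z : Space N), Measurable fun x => J (R, z, x) := fun R z =>
    hJm.comp (by fun_prop)
  have h1 : c * rieszEnergy μ ν₁ ν₂ = ∫⁻ x, ∫⁻ y, ballKernel μ x y ∂ν₂ ∂ν₁ := by
    rw [rieszEnergy, ← lintegral_const_mul' _ _ hct]
    congr 1; ext x
    rw [← lintegral_const_mul' _ _ hct]
    refine lintegral_congr_ae ?_
    filter_upwards [Measure.ae_ne ν₂ x] with y hy
    rw [hc x y hy.symm]
  have hswap : ∀ R : ℝ, ∫⁻ x, ∫⁻ y, (w R * ∫⁻ z, J (R, z, x) * J (R, z, y)) ∂ν₂ ∂ν₁ =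
      w R * ∫⁻ z, ν₁ (ball z R) * ν₂ (ball z R) := by
    intro R
    simp_rw [lintegral_const_mul' _ _ (show w R ≠ ⊤ from ENNReal.ofReal_ne_top)]
    congr 1
    have ha : ∀ x, ∫⁻ y, (∫⁻ z, J (R, z, x) * J (R, z, y)) ∂ν₂ =
        ∫⁻ z, J (R, z, x) * ν₂ (ball z R) := by
      intro x
      rw [lintegral_lintegral_swap]
      · refine lintegral_congr fun z => ?_
        rw [lintegral_const_mul _ (hJz R z), hJball]
      · exact ((hJm.comp (f := fun q : Space N × Space N => (R, q.2, x)) (by fun_prop)).mul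
          (hJm.comp (f := fun q : Space N × Space N => (R, q.2, q.1)) (by fun_prop))).aemeasurable
    simp_rw [ha]
    have hb := (measurable_measure_ball ν₂).comp (f := fun z : Space N => (R, z)) (by fun_prop)
    rw [lintegral_lintegral_swap]
    · refine lintegral_congr fun z => ?_
      rw [lintegral_mul_const _ (hJz R z), hJball]
    · exact ((hJm.comp (f := fun q : Space N × Space N => (R, q.2, q.1)) (by fun_prop)).mul
          (hb.comp measurable_snd)).aemeasurable
  have hm : Measurable fun q : (Space N × Space N) × ℝ =>
      w q.2 * ∫⁻ z, J (q.2, z, q.1.1) * J (q.2, z, q.1.2) := by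
    refine (hwm.comp measurable_snd).mul (Measurable.lintegral_prod_right'
      (f := fun r : ((Space N × Space N) × ℝ) × Space N =>
        J (r.1.2, r.2, r.1.1.1) * J (r.1.2, r.2, r.1.1.2)) ?_)
    exact (hJm.comp (by fun_prop)).mul (hJm.comp (by fun_prop))
  rw [h1]
  change _ = ∫⁻ R in Ioi (0 : ℝ), w R * ∫⁻ z, ν₁ (ball z R) * ν₂ (ball z R)
  simp_rw [← hswap]
  rw [lintegral_lintegral_swap (μ := volume.restrict (Ioi 0))]
  · congr 1; ext x
    rw [lintegral_lintegral_swap (μ := volume.restrict (Ioi 0))]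
    · simp_rw [ballKernel, hJvol]; rfl
    · exact (hm.comp (f := fun q : ℝ × Space N => ((x, q.2), q.1)) (by fun_prop)).aemeasurable
  · refine Measurable.aemeasurable (Measurable.lintegral_prod_right'
      (f := fun r : (ℝ × Space N) × Space N => w r.1.1 *
        ∫⁻ z, J (r.1.1, z, r.1.2) * J (r.1.1, z, r.2)) ?_)
    exact hm.comp (f := fun r : (ℝ × Space N) × Space N => ((r.1.2, r.2), r.1.1)) (by fun_prop)

/-! ### The energy gap between a measure and its halves -/

theorem ENNReal_add_sq_le {τ : ℝ≥0∞} (h0 : τ ≠ 0) (ht : τ ≠ ⊤) (a b : ℝ≥0∞) :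
    (a + b) ^ 2 ≤ (1 + τ) ^ 2 * a ^ 2 + (1 + τ⁻¹) ^ 2 * b ^ 2 := by
  rcases le_total b (τ * a) with h | h
  · calc (a + b) ^ 2 ≤ (a + τ * a) ^ 2 := by gcongr
      _ = (1 + τ) ^ 2 * a ^ 2 := by ring
      _ ≤ _ := le_self_add
  · have h' : a ≤ τ⁻¹ * b := by
      calc a = τ⁻¹ * (τ * a) := by rw [← mul_assoc, ENNReal.inv_mul_cancel h0 ht, one_mul]
        _ ≤ _ := by gcongr
    calc (a + b) ^ 2 ≤ (τ⁻¹ * b + b) ^ 2 := by gcongr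
      _ = (1 + τ⁻¹) ^ 2 * b ^ 2 := by ring
      _ ≤ _ := le_add_self

/-- A Hardy inequality on dyadic scales: a function `G` of the radius is controlled in
`L²(R ^ (-(μ + 1)) dR)` by its increments between `R / 2` and `R`. -/
theorem exists_lintegral_sq_le_of_dyadic_increment {μ : ℝ} (hμ : 0 < μ) :
    ∃ C : ℝ≥0∞, C ≠ ⊤ ∧ ∀ G h : ℝ → ℝ≥0∞, Measurable G →
      (∀ R > 0, G R ≤ G (2⁻¹ * R) + h R) →
      ∫⁻ R in Ioi (0 : ℝ), ENNReal.ofReal (R ^ (-(μ + 1))) * G R ^ 2 ≠ ⊤ →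
      ∫⁻ R in Ioi (0 : ℝ), ENNReal.ofReal (R ^ (-(μ + 1))) * G R ^ 2 ≤
        C * ∫⁻ R in Ioi (0 : ℝ), ENNReal.ofReal (R ^ (-(μ + 1))) * h R ^ 2 := by
  -- `τ` is chosen so that `(1 + τ) ^ 2 * 2 ^ (-μ) = 2 ^ (-μ / 2) < 1`.
  set t : ℝ := 2 ^ (μ / 4) - 1 with ht
  have ht0 : 0 < t := sub_pos.mpr (Real.one_lt_rpow (by norm_num) (by positivity))
  set τ := ENNReal.ofReal t with hτ
  have hτ0 : τ ≠ 0 := by rw [hτ, Ne, ENNReal.ofReal_eq_zero, not_le]; exact ht0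
  have hτt : τ ≠ ⊤ := ENNReal.ofReal_ne_top
  set θ : ℝ := 2 ^ (-(μ / 2)) with hθ
  have hθ1 : θ < 1 := Real.rpow_lt_one_of_one_lt_of_neg (by norm_num) (by linarith)
  have hθ0 : 0 < θ := by positivity
  have hθτ : (1 + τ) ^ 2 * ENNReal.ofReal ((2⁻¹ : ℝ) ^ μ) = ENNReal.ofReal θ := by
    rw [hτ, ← ENNReal.ofReal_one, ← ENNReal.ofReal_add zero_le_one ht0.le,
      ← ENNReal.ofReal_pow (by positivity), ← ENNReal.ofReal_mul (by positivity)]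
    congr 1
    rw [ht, add_sub_cancel, Real.inv_rpow (by norm_num), ← Real.rpow_neg (by norm_num),
      ← Real.rpow_natCast, ← Real.rpow_mul (by norm_num), ← Real.rpow_add (by norm_num), hθ]
    congr 1; push_cast; ring
  refine ⟨ENNReal.ofReal (1 - θ)⁻¹ * (1 + τ⁻¹) ^ 2, ?_, fun G h hG hGh hI => ?_⟩
  · refine ENNReal.mul_ne_top ENNReal.ofReal_ne_top (ENNReal.pow_ne_top ?_)
    exact ENNReal.add_ne_top.mpr ⟨ENNReal.one_ne_top, ENNReal.inv_ne_top.mpr hτ0⟩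
  set I := ∫⁻ R in Ioi (0 : ℝ), ENNReal.ofReal (R ^ (-(μ + 1))) * G R ^ 2 with hIdef
  set J := ∫⁻ R in Ioi (0 : ℝ), ENNReal.ofReal (R ^ (-(μ + 1))) * h R ^ 2 with hJdef
  have hb : (1 + τ⁻¹) ^ 2 ≠ ⊤ :=
    ENNReal.pow_ne_top (ENNReal.add_ne_top.mpr ⟨ENNReal.one_ne_top, ENNReal.inv_ne_top.mpr hτ0⟩)
  have ha : (1 + τ) ^ 2 ≠ ⊤ :=
    ENNReal.pow_ne_top (ENNReal.add_ne_top.mpr ⟨ENNReal.one_ne_top, hτt⟩)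
  have h1 : I ≤ ENNReal.ofReal θ * I + (1 + τ⁻¹) ^ 2 * J := by
    calc I ≤ ∫⁻ R in Ioi (0 : ℝ), ((1 + τ) ^ 2 * (ENNReal.ofReal (R ^ (-(μ + 1))) *
            G (2⁻¹ * R) ^ 2) + (1 + τ⁻¹) ^ 2 * (ENNReal.ofReal (R ^ (-(μ + 1))) * h R ^ 2)) := by
          refine setLIntegral_mono' measurableSet_Ioi fun R hR => ?_
          calc _ ≤ ENNReal.ofReal (R ^ (-(μ + 1))) * ((1 + τ) ^ 2 * G (2⁻¹ * R) ^ 2 +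
                (1 + τ⁻¹) ^ 2 * h R ^ 2) := by
                gcongr
                exact (pow_le_pow_left₀ zero_le (hGh R hR) 2).trans
                  (ENNReal_add_sq_le hτ0 hτt _ _)
            _ = _ := by ring
      _ = _ := by
          rw [lintegral_add_left (by fun_prop), lintegral_const_mul' _ _ ha,
            lintegral_const_mul' _ _ hb,
            lintegral_Ioi_rpow_mul_comp_mul μ (fun R => G R ^ 2) (by norm_num : (0 : ℝ) < 2⁻¹),
            ← mul_assoc, hθτ]
  have h2 : ENNReal.ofReal (1 - θ) * I ≤ (1 + τ⁻¹) ^ 2 * J := by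
    have h3 : I = ENNReal.ofReal θ * I + ENNReal.ofReal (1 - θ) * I := by
      rw [← add_mul, ← ENNReal.ofReal_add hθ0.le (by linarith), add_sub_cancel,
        ENNReal.ofReal_one, one_mul]
    exact (ENNReal.add_le_add_iff_left (ENNReal.mul_ne_top ENNReal.ofReal_ne_top hI)).mp
      (h3.symm.le.trans h1)
  calc I = ENNReal.ofReal (1 - θ)⁻¹ * (ENNReal.ofReal (1 - θ) * I) := by
        rw [← mul_assoc, ← ENNReal.ofReal_mul (inv_nonneg.mpr (by linarith)),
          inv_mul_cancel₀ (by linarith), ENNReal.ofReal_one, one_mul]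
    _ ≤ ENNReal.ofReal (1 - θ)⁻¹ * ((1 + τ⁻¹) ^ 2 * J) := by gcongr
    _ = _ := by rw [mul_assoc]

theorem lintegral_measure_ball {N : ℕ} (ν : Measure (Space N)) [SFinite ν] (r : ℝ) :
    ∫⁻ z, ν (ball z r) = volume (ball (0 : Space N) r) * ν univ := by
  have hm : MeasurableSet {q : Space N × Space N | dist q.2 q.1 < r} :=
    (isOpen_lt (by fun_prop) (by fun_prop)).measurableSet
  have h1 := Measure.prod_apply (μ := (volume : Measure (Space N))) (ν := ν) hm
  have h2 := Measure.prod_apply_symm (μ := (volume : Measure (Space N))) (ν := ν) hm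
  have h3 : ∀ x : Space N, (volume : Measure (Space N))
      ((fun z => (z, x)) ⁻¹' {q : Space N × Space N | dist q.2 q.1 < r}) =
      volume (ball (0 : Space N) r) := by
    intro x
    rw [← Measure.addHaar_ball_center volume x r]
    congr 1; ext z; simp [dist_comm]
  simp_rw [h3] at h2
  rw [lintegral_const] at h2
  rw [← h2, h1]
  rfl

theorem sq_setLIntegral_le {α : Type*} [MeasurableSpace α] (m : Measure α) (S : Set α)
    {g : α → ℝ≥0∞} (hg : Measurable g) :
    (∫⁻ x in S, g x ∂m) ^ 2 ≤ m S * ∫⁻ x in S, g x ^ 2 ∂m := by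
  have h := ENNReal.lintegral_mul_le_Lp_mul_Lq (m.restrict S) Real.HolderConjugate.two_two
    (aemeasurable_const (b := (1 : ℝ≥0∞))) hg.aemeasurable
  simp only [Pi.mul_apply, one_mul, ENNReal.one_rpow, lintegral_const,
    Measure.restrict_apply_univ] at h
  calc _ ≤ ((m S) ^ (1 / 2 : ℝ) * (∫⁻ x in S, g x ^ (2 : ℝ) ∂m) ^ (1 / 2 : ℝ)) ^ 2 := by
        gcongr
    _ = _ := by
        rw [mul_pow, ← ENNReal.rpow_natCast, ← ENNReal.rpow_natCast, ← ENNReal.rpow_mul,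
          ← ENNReal.rpow_mul]
        simp

/-- The open cube with centre `o` and half-side `R`. -/
def cube {N : ℕ} (o : Space N) (R : ℝ) : Set (Space N) := {x | ∀ i, |x i - o i| < R}

theorem isOpen_cube {N : ℕ} (o : Space N) (R : ℝ) : IsOpen (cube o R) := by
  have : cube o R = ⋂ i, {x : Space N | |x i - o i| < R} := by ext; simp [cube]
  rw [this]
  exact isOpen_iInter_of_finite fun i => isOpen_lt (by fun_prop) (by fun_prop)

theorem cube_subset_ball {N : ℕ} (o : Space N) {R : ℝ} (hR : 0 < R) :
    cube o R ⊆ ball o ((N + 1) * R) := by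
  intro x hx
  rw [mem_ball, dist_eq_norm]
  have h1 : ‖x - o‖ ^ 2 ≤ N * R ^ 2 := by
    rw [EuclideanSpace.norm_sq_eq]
    calc _ ≤ ∑ i : Fin N, R ^ 2 := Finset.sum_le_sum fun i _ => by
          have := hx i
          rw [Real.norm_eq_abs]
          exact pow_le_pow_left₀ (abs_nonneg _) this.le 2
      _ = _ := by simp
  have hN : (0 : ℝ) ≤ N := Nat.cast_nonneg _
  refine lt_of_pow_lt_pow_left₀ 2 (by positivity) (h1.trans_lt ?_)
  have : 0 < R ^ 2 := by positivity
  nlinarith [mul_nonneg hN this.le, mul_nonneg (mul_nonneg hN hN) this.le]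

theorem abs_coord_sub_lt {N : ℕ} {x z : Space N} {r : ℝ} (h : x ∈ ball z r) (i : Fin N) :
    |x i - z i| < r := by
  rw [mem_ball, dist_eq_norm] at h
  exact lt_of_le_of_lt (by simpa using PiLp.norm_apply_le (x - z) i) h

theorem volume_ball_eq {N : ℕ} (o : Space N) {R : ℝ} (hR : 0 < R) :
    volume (ball o R) = ENNReal.ofReal (R ^ (N : ℝ)) * volume (ball (0 : Space N) 1) := by
  rw [Measure.addHaar_ball_of_pos volume _ hR, finrank_euclideanSpace, Fintype.card_fin,
    Real.rpow_natCast]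

/-- The part of the ball representation of the energy of `ν` that comes from the balls lying on
one side of the hyperplane `{x | x i = o i}`. -/
noncomputable def sideBallEnergy {N : ℕ} (μ : ℝ) (ν : Measure (Space N)) (o : Space N)
    (i : Fin N) : ℝ≥0∞ :=
  ∫⁻ R in Ioi (0 : ℝ), ENNReal.ofReal (R ^ (-(μ + N + 1))) *
    ∫⁻ z in {z : Space N | R ≤ |z i - o i|}, ν (ball z R) ^ 2

theorem measurableSet_coord {N : ℕ} (o : Space N) (i : Fin N) (R : ℝ) :
    MeasurableSet {z : Space N | R ≤ |z i - o i|} :=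
  (isClosed_le (by fun_prop) (by fun_prop)).measurableSet

theorem measurable_measure_ball_right {N : ℕ} (ν : Measure (Space N)) [SFinite ν] (R : ℝ) :
    Measurable fun z : Space N => ν (ball z R) :=
  (measurable_measure_ball ν).comp (f := fun z : Space N => (R, z)) (by fun_prop)

/-- The mass of a slab of the shell between two cubes is controlled by the masses of the balls
that meet the slab, all of which avoid the hyperplane `{x | x i = o i}`. -/
theorem measure_slab_sq_le {N : ℕ} (ν : Measure (Space N)) [SFinite ν] (o : Space N) (i : Fin N)
    {R : ℝ} (hR : 0 < R) :
    (ENNReal.ofReal ((4⁻¹ * R) ^ (N : ℝ)) * volume (ball (0 : Space N) 1) *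
        ν {x | x ∈ cube o R ∧ 2⁻¹ * R ≤ |x i - o i|}) ^ 2 ≤
      ENNReal.ofReal (((N + 1) * (2 * R)) ^ (N : ℝ)) * volume (ball (0 : Space N) 1) *
        ∫⁻ z in {z : Space N | 4⁻¹ * R ≤ |z i - o i|}, ν (ball z (4⁻¹ * R)) ^ 2 := by
  set A := {x | x ∈ cube o R ∧ 2⁻¹ * R ≤ |x i - o i|} with hA
  set S := {z : Space N | 4⁻¹ * R ≤ |z i - o i|} with hS
  have hAm : MeasurableSet A :=
    (isOpen_cube o R).measurableSet.inter (measurableSet_coord o i _)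
  have h1 := lintegral_measure_ball (ν.restrict A) (4⁻¹ * R)
  rw [Measure.restrict_apply_univ, volume_ball_eq _ (by positivity)] at h1
  rw [← h1]
  have hsub : ∀ z, ν.restrict A (ball z (4⁻¹ * R)) ≤
      (S ∩ cube o (2 * R)).indicator (fun z => ν (ball z (4⁻¹ * R))) z := by
    intro z
    by_cases hz : z ∈ S ∩ cube o (2 * R)
    · rw [indicator_of_mem hz]
      exact Measure.restrict_apply_le _ _
    · rw [indicator_of_notMem hz, Measure.restrict_apply measurableSet_ball]
      refine (measure_mono_null ?_ (measure_empty (μ := ν))).le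
      rintro x ⟨hxz, hxA⟩
      refine hz ⟨?_, fun j => ?_⟩
      · have ha := abs_coord_sub_lt hxz i
        have hb := hxA.2
        have hc := abs_sub_le (x i) (z i) (o i)
        simp only [hS, mem_ofPred_eq]
        linarith
      · have ha := abs_coord_sub_lt hxz j
        have hb := hxA.1 j
        have hc := abs_sub_le (z j) (x j) (o j)
        rw [abs_sub_comm (z j) (x j)] at hc
        linarith
  have hSm : MeasurableSet (S ∩ cube o (2 * R)) :=
    (measurableSet_coord o i _).inter (isOpen_cube o _).measurableSet
  calc _ ≤ (∫⁻ z in S ∩ cube o (2 * R), ν (ball z (4⁻¹ * R))) ^ 2 := by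
        rw [← lintegral_indicator hSm]
        gcongr with z
        exact hsub z
    _ ≤ volume (S ∩ cube o (2 * R)) * ∫⁻ z in S ∩ cube o (2 * R), ν (ball z (4⁻¹ * R)) ^ 2 :=
        sq_setLIntegral_le _ _ (measurable_measure_ball_right ν _)
    _ ≤ _ := by
        rw [← volume_ball_eq o (by positivity)]
        gcongr
        · exact inter_subset_right.trans (cube_subset_ball o (by positivity))
        · exact inter_subset_left

theorem exists_lintegral_slab_sq_le (N : ℕ) (μ : ℝ) :
    ∃ C : ℝ≥0∞, C ≠ ⊤ ∧ ∀ (ν : Measure (Space N)) [SFinite ν] (o : Space N) (i : Fin N),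
      ∫⁻ R in Ioi (0 : ℝ), ENNReal.ofReal (R ^ (-(μ + 1))) *
        ν {x | x ∈ cube o R ∧ 2⁻¹ * R ≤ |x i - o i|} ^ 2 ≤ C * sideBallEnergy μ ν o i := by
  set κ := volume (ball (0 : Space N) 1) with hκ
  have hκ0 : κ ≠ 0 := (measure_ball_pos volume (0 : Space N) one_pos).ne'
  have hκt : κ ≠ ⊤ := measure_ball_lt_top.ne
  set K : ℝ := ((4 : ℝ) ^ N) ^ 2 * (2 * (N + 1)) ^ N with hK
  refine ⟨ENNReal.ofReal K * κ⁻¹ * ENNReal.ofReal ((4⁻¹ : ℝ) ^ (μ + N)), ?_,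
    fun ν _ o i => ?_⟩
  · exact ENNReal.mul_ne_top (ENNReal.mul_ne_top ENNReal.ofReal_ne_top
      (ENNReal.inv_ne_top.mpr hκ0)) ENNReal.ofReal_ne_top
  have hscale := lintegral_Ioi_rpow_mul_comp_mul (μ + N)
    (fun r => ∫⁻ z in {z : Space N | r ≤ |z i - o i|}, ν (ball z r) ^ 2)
    (by norm_num : (0 : ℝ) < 4⁻¹)
  rw [sideBallEnergy, mul_assoc, ← hscale,
    ← lintegral_const_mul' _ _ (ENNReal.mul_ne_top ENNReal.ofReal_ne_top
      (ENNReal.inv_ne_top.mpr hκ0))]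
  refine setLIntegral_mono' measurableSet_Ioi fun R hR => ?_
  rw [mem_Ioi] at hR
  set X := ν {x | x ∈ cube o R ∧ 2⁻¹ * R ≤ |x i - o i|} with hX
  set Y := ∫⁻ z in {z : Space N | 4⁻¹ * R ≤ |z i - o i|}, ν (ball z (4⁻¹ * R)) ^ 2 with hY
  have h := measure_slab_sq_le ν o i hR
  rw [← hX, ← hY, ← hκ, mul_pow, mul_pow, ← ENNReal.ofReal_pow (by positivity)] at h
  have h2 : ENNReal.ofReal (R ^ (-(μ + 1))) * X ^ 2 =
      ENNReal.ofReal (R ^ (-(μ + 1)) * (((4⁻¹ * R) ^ (N : ℝ)) ^ 2)⁻¹) * (κ⁻¹) ^ 2 *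
      (ENNReal.ofReal (((4⁻¹ * R) ^ (N : ℝ)) ^ 2) * κ ^ 2 * X ^ 2) := by
    have e1 : (κ⁻¹) ^ 2 * κ ^ 2 = 1 := by
      rw [← mul_pow, ENNReal.inv_mul_cancel hκ0 hκt, one_pow]
    have e2 : ENNReal.ofReal (R ^ (-(μ + 1)) * (((4⁻¹ * R) ^ (N : ℝ)) ^ 2)⁻¹) *
        ENNReal.ofReal (((4⁻¹ * R) ^ (N : ℝ)) ^ 2) = ENNReal.ofReal (R ^ (-(μ + 1))) := by
      rw [← ENNReal.ofReal_mul (by positivity), inv_mul_cancel_right₀ (by positivity)]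
    calc _ = ENNReal.ofReal (R ^ (-(μ + 1))) * 1 * X ^ 2 := by rw [mul_one]
      _ = _ := by rw [← e2, ← e1]; ring
  rw [h2]
  calc _ ≤ ENNReal.ofReal (R ^ (-(μ + 1)) * (((4⁻¹ * R) ^ (N : ℝ)) ^ 2)⁻¹) * (κ⁻¹) ^ 2 *
        (ENNReal.ofReal (((N + 1) * (2 * R)) ^ (N : ℝ)) * κ * Y) := by gcongr
    _ = (ENNReal.ofReal (R ^ (-(μ + 1)) * (((4⁻¹ * R) ^ (N : ℝ)) ^ 2)⁻¹) *
        ENNReal.ofReal (((N + 1) * (2 * R)) ^ (N : ℝ))) * κ⁻¹ * (κ⁻¹ * κ) * Y := by ring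
    _ = ENNReal.ofReal (K * R ^ (-(μ + N + 1))) * κ⁻¹ * Y := by
        rw [ENNReal.inv_mul_cancel hκ0 hκt, mul_one, ← ENNReal.ofReal_mul (by positivity)]
        congr 3
        have e3 : R ^ (-(μ + 1)) = R ^ (-(μ + N + 1)) * R ^ N := by
          rw [← Real.rpow_natCast, ← Real.rpow_add hR]; congr 1; ring
        have e4 : R ^ N ≠ 0 := by positivity
        have e5 : (4 : ℝ) ^ N ≠ 0 := by positivity
        rw [hK, Real.rpow_natCast, Real.rpow_natCast, e3, show ((N : ℝ) + 1) * (2 * R) =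
          2 * (N + 1) * R by ring, mul_pow, mul_pow _ R, inv_pow]
        generalize R ^ (-(μ + N + 1)) = w
        field_simp
    _ = _ := by
        rw [ENNReal.ofReal_mul (show 0 ≤ K by positivity)]
        ring

theorem measurable_measure_cube {N : ℕ} (ν : Measure (Space N)) (o : Space N) :
    Measurable fun R => ν (cube o R) :=
  Monotone.measurable fun _ _ h => measure_mono fun _ hx i => (hx i).trans_le h

/-- The energy in the ball representation is finite only if the masses of concentric cubes are
square integrable in the radius against `R ^ (-(μ + 1))`. -/
theorem lintegral_cube_sq_ne_top {N : ℕ} {μ : ℝ} (ν : Measure (Space N)) [SFinite ν]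
    (o : Space N)
    (hfin : ∫⁻ R in Ioi (0 : ℝ), ENNReal.ofReal (R ^ (-(μ + N + 1))) *
      ∫⁻ z, ν (ball z R) * ν (ball z R) ≠ ⊤) :
    ∫⁻ R in Ioi (0 : ℝ), ENNReal.ofReal (R ^ (-(μ + 1))) * ν (cube o R) ^ 2 ≠ ⊤ := by
  set κ := volume (ball (0 : Space N) 1) with hκ
  have hκ0 : κ ≠ 0 := (measure_ball_pos volume (0 : Space N) one_pos).ne'
  have hκt : κ ≠ ⊤ := measure_ball_lt_top.ne
  have hK : (0 : ℝ) < N + 2 := by positivity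
  have hscale := lintegral_Ioi_rpow_mul_comp_mul (μ + N)
    (fun r => ∫⁻ z, ν (ball z r) * ν (ball z r)) hK
  have hle : κ * ∫⁻ R in Ioi (0 : ℝ), ENNReal.ofReal (R ^ (-(μ + 1))) * ν (cube o R) ^ 2 ≤
      ∫⁻ R in Ioi (0 : ℝ), ENNReal.ofReal (R ^ (-(μ + N + 1))) *
        ∫⁻ z, ν (ball z ((N + 2) * R)) * ν (ball z ((N + 2) * R)) := by
    rw [← lintegral_const_mul' _ _ hκt]
    refine setLIntegral_mono' measurableSet_Ioi fun R hR => ?_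
    rw [mem_Ioi] at hR
    calc _ = ENNReal.ofReal (R ^ (-(μ + N + 1))) *
          ∫⁻ z in ball o R, ν (cube o R) * ν (cube o R) := by
          rw [setLIntegral_const, volume_ball_eq o hR, ← hκ,
            show -(μ + 1) = -(μ + N + 1) + (N : ℝ) by ring, Real.rpow_add hR,
            ENNReal.ofReal_mul (by positivity)]
          ring
      _ ≤ ENNReal.ofReal (R ^ (-(μ + N + 1))) *
          ∫⁻ z in ball o R, ν (ball z ((N + 2) * R)) * ν (ball z ((N + 2) * R)) := by
          refine mul_le_mul_right ?_ _
          refine setLIntegral_mono' measurableSet_ball fun z hz => ?_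
          have : cube o R ⊆ ball z ((N + 2) * R) := by
            refine (cube_subset_ball o hR).trans (ball_subset_ball' ?_)
            rw [mem_ball, dist_comm] at hz
            linarith
          gcongr
      _ ≤ _ := mul_le_mul_right (setLIntegral_le_lintegral _ _) _
  intro htop
  rw [htop, ENNReal.mul_top hκ0, top_le_iff, hscale] at hle
  exact ENNReal.mul_ne_top ENNReal.ofReal_ne_top hfin hle

/-- The balls that avoid one of the `N` coordinate hyperplanes through `o` carry a fixed proportion
of the energy. -/
theorem exists_ballEnergy_le_sum_sideBallEnergy {N : ℕ} {μ : ℝ} (hμ : 0 < μ) :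
    ∃ C : ℝ≥0∞, C ≠ ⊤ ∧ ∀ (ν : Measure (Space N)) [SFinite ν] (o : Space N),
      ∫⁻ R in Ioi (0 : ℝ), ENNReal.ofReal (R ^ (-(μ + N + 1))) *
        ∫⁻ z, ν (ball z R) * ν (ball z R) ≠ ⊤ →
      ∫⁻ R in Ioi (0 : ℝ), ENNReal.ofReal (R ^ (-(μ + N + 1))) *
        ∫⁻ z, ν (ball z R) * ν (ball z R) ≤ C * ∑ i, sideBallEnergy μ ν o i := by
  obtain ⟨C₁, hC₁, h₁⟩ := exists_lintegral_slab_sq_le N μ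
  obtain ⟨C₂, hC₂, h₂⟩ := exists_lintegral_sq_le_of_dyadic_increment hμ
  set κ := volume (ball (0 : Space N) 1) with hκ
  have hκt : κ ≠ ⊤ := measure_ball_lt_top.ne
  set C₃ : ℝ≥0∞ := ENNReal.ofReal (((N : ℝ) + 1) ^ (N : ℝ)) * κ * ENNReal.ofReal (2 ^ μ) with hC₃
  refine ⟨C₃ * (C₂ * (N * C₁)) + 1, ?_, fun ν _ o hfin => ?_⟩
  · refine ENNReal.add_ne_top.mpr ⟨ENNReal.mul_ne_top ?_ ?_, ENNReal.one_ne_top⟩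
    · exact ENNReal.mul_ne_top (ENNReal.mul_ne_top ENNReal.ofReal_ne_top hκt)
        ENNReal.ofReal_ne_top
    · exact ENNReal.mul_ne_top hC₂ (ENNReal.mul_ne_top (ENNReal.natCast_ne_top N) hC₁)
  set I := ∫⁻ R in Ioi (0 : ℝ), ENNReal.ofReal (R ^ (-(μ + 1))) * ν (cube o R) ^ 2 with hI
  -- The balls meeting all the hyperplanes lie in cubes centred at `o`.
  have hnear : ∀ R > 0, ENNReal.ofReal (R ^ (-(μ + N + 1))) *
      ∫⁻ z in cube o R, ν (ball z R) * ν (ball z R) ≤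
      ENNReal.ofReal (((N : ℝ) + 1) ^ (N : ℝ)) * κ *
        (ENNReal.ofReal (R ^ (-(μ + 1))) * ν (cube o (2 * R)) ^ 2) := by
    intro R hR
    have hsub : ∀ z ∈ cube o R, ball z R ⊆ cube o (2 * R) := by
      intro z hz x hx j
      have ha := abs_coord_sub_lt hx j
      have hb := hz j
      have hc := abs_sub_le (x j) (z j) (o j)
      linarith
    calc _ ≤ ENNReal.ofReal (R ^ (-(μ + N + 1))) *
          ∫⁻ z in cube o R, ν (cube o (2 * R)) * ν (cube o (2 * R)) := by
          refine mul_le_mul_right ?_ _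
          refine setLIntegral_mono' (isOpen_cube o R).measurableSet fun z hz => ?_
          gcongr <;> exact hsub z hz
      _ ≤ ENNReal.ofReal (R ^ (-(μ + N + 1))) * (ν (cube o (2 * R)) * ν (cube o (2 * R)) *
          volume (ball o ((N + 1) * R))) := by
          rw [setLIntegral_const]
          gcongr
          exact cube_subset_ball o hR
      _ = _ := by
          rw [volume_ball_eq o (by positivity), ← hκ, Real.mul_rpow (by positivity) hR.le,
            ENNReal.ofReal_mul (by positivity),
            show -(μ + 1) = -(μ + N + 1) + (N : ℝ) by ring, Real.rpow_add hR,
            ENNReal.ofReal_mul (by positivity)]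
          ring
  have hA : ∫⁻ R in Ioi (0 : ℝ), ENNReal.ofReal (R ^ (-(μ + N + 1))) *
      ∫⁻ z, ν (ball z R) * ν (ball z R) ≤ C₃ * I + ∑ i, sideBallEnergy μ ν o i := by
    have hcov : ∀ R : ℝ, ∫⁻ z, ν (ball z R) * ν (ball z R) ≤
        (∫⁻ z in cube o R, ν (ball z R) * ν (ball z R)) +
        ∑ i, ∫⁻ z in {z : Space N | R ≤ |z i - o i|}, ν (ball z R) ^ 2 := by
      intro R
      have hu : (univ : Set (Space N)) ⊆ cube o R ∪ ⋃ i, {z : Space N | R ≤ |z i - o i|} := by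
        intro z _
        by_cases hz : z ∈ cube o R
        · exact Or.inl hz
        · simp only [cube, mem_ofPred_eq, not_forall, not_lt] at hz
          exact Or.inr (mem_iUnion.mpr hz)
      calc _ = ∫⁻ z in univ, ν (ball z R) * ν (ball z R) := by rw [Measure.restrict_univ]
        _ ≤ _ := lintegral_mono_set hu
        _ ≤ _ := lintegral_union_le _ _ _
        _ ≤ _ := by
            gcongr
            refine (lintegral_iUnion_le _ _).trans ?_
            rw [tsum_fintype]
            simp_rw [sq]
            exact le_rfl
    have hmeas : ∀ S : ℝ → Set (Space N), MeasurableSet {q : ℝ × Space N | q.2 ∈ S q.1} →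
        Measurable fun R => ENNReal.ofReal (R ^ (-(μ + N + 1))) *
          ∫⁻ z in S R, ν (ball z R) ^ 2 := by
      intro S hS
      refine Measurable.mul (by fun_prop) ?_
      have : ∀ R, ∫⁻ z in S R, ν (ball z R) ^ 2 = ∫⁻ z, {q : ℝ × Space N | q.2 ∈ S q.1}.indicator
          (fun q => ν (ball q.2 q.1) ^ 2) (R, z) := by
        intro R
        rw [← lintegral_indicator (show MeasurableSet (S R) from measurable_prodMk_left hS)]
        rfl
      simp_rw [this]
      exact Measurable.lintegral_prod_right'
        (((measurable_measure_ball ν).pow_const 2).indicator hS)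
    have hmi : ∀ i : Fin N, Measurable fun R : ℝ => ENNReal.ofReal (R ^ (-(μ + N + 1))) *
        ∫⁻ z in {z : Space N | R ≤ |z i - o i|}, ν (ball z R) ^ 2 := fun i =>
      hmeas (fun R => {z | R ≤ |z i - o i|})
        (show IsClosed {q : ℝ × Space N | q.1 ≤ |q.2 i - o i|} from
          isClosed_le (by fun_prop) (by fun_prop)).measurableSet
    calc _ ≤ ∫⁻ R in Ioi (0 : ℝ), (ENNReal.ofReal (((N : ℝ) + 1) ^ (N : ℝ)) * κ *
          (ENNReal.ofReal (R ^ (-(μ + 1))) * ν (cube o (2 * R)) ^ 2) +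
          ∑ i, ENNReal.ofReal (R ^ (-(μ + N + 1))) *
            ∫⁻ z in {z : Space N | R ≤ |z i - o i|}, ν (ball z R) ^ 2) := by
          refine setLIntegral_mono' measurableSet_Ioi fun R hR => ?_
          calc _ ≤ _ := mul_le_mul_right (hcov R) _
            _ ≤ _ := by
              rw [mul_add, Finset.mul_sum]
              exact add_le_add_left (hnear R hR) _
      _ = _ := by
          rw [lintegral_add_right _ (Finset.measurable_fun_sum _ fun i _ => hmi i),
            lintegral_finsetSum _ fun i _ => hmi i,
            lintegral_const_mul' _ _ (ENNReal.mul_ne_top ENNReal.ofReal_ne_top hκt),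
            lintegral_Ioi_rpow_mul_comp_mul μ (fun R => ν (cube o R) ^ 2)
              (by norm_num : (0 : ℝ) < 2), ← mul_assoc]
          simp only [hC₃, hI, sideBallEnergy]
  have hshell : ∀ R > 0, ν (cube o R) ≤ ν (cube o (2⁻¹ * R)) +
      ∑ i, ν {x | x ∈ cube o R ∧ 2⁻¹ * R ≤ |x i - o i|} := by
    intro R hR
    have hu : cube o R ⊆ cube o (2⁻¹ * R) ∪
        ⋃ i, {x | x ∈ cube o R ∧ 2⁻¹ * R ≤ |x i - o i|} := by
      intro z hz
      by_cases hz' : z ∈ cube o (2⁻¹ * R)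
      · exact Or.inl hz'
      · rw [cube, mem_ofPred_eq] at hz'
        push Not at hz'
        obtain ⟨i, hi⟩ := hz'
        exact Or.inr (mem_iUnion.mpr ⟨i, hz, hi⟩)
    refine (measure_mono hu).trans ((measure_union_le _ _).trans ?_)
    gcongr
    exact measure_iUnion_fintype_le _ _
  have hB : I ≤ C₂ * (N * C₁) * ∑ i, sideBallEnergy μ ν o i := by
    refine (h₂ _ _ (measurable_measure_cube ν o) hshell
      (lintegral_cube_sq_ne_top ν o hfin)).trans ?_
    rw [mul_assoc]
    gcongr
    have hsm : ∀ i : Fin N, Measurable fun R : ℝ => ENNReal.ofReal (R ^ (-(μ + 1))) *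
        ν {x | x ∈ cube o R ∧ 2⁻¹ * R ≤ |x i - o i|} ^ 2 := by
      intro i
      refine Measurable.mul (by fun_prop) (Measurable.pow_const ?_ 2)
      refine measurable_measure_prodMk_left (ν := ν)
        (s := {q : ℝ × Space N | q.2 ∈ cube o q.1 ∧ 2⁻¹ * q.1 ≤ |q.2 i - o i|}) ?_
      refine MeasurableSet.inter (s₁ := {q : ℝ × Space N | q.2 ∈ cube o q.1}) ?_
        (show IsClosed {q : ℝ × Space N | 2⁻¹ * q.1 ≤ |q.2 i - o i|} from
          isClosed_le (by fun_prop) (by fun_prop)).measurableSet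
      have : {q : ℝ × Space N | q.2 ∈ cube o q.1} = ⋂ i, {q | |q.2 i - o i| < q.1} := by
        ext; simp [cube]
      rw [this]
      exact MeasurableSet.iInter fun i => (isOpen_lt (by fun_prop) (by fun_prop)).measurableSet
    calc _ ≤ ∫⁻ R in Ioi (0 : ℝ), N * ∑ i, ENNReal.ofReal (R ^ (-(μ + 1))) *
          ν {x | x ∈ cube o R ∧ 2⁻¹ * R ≤ |x i - o i|} ^ 2 := by
          refine lintegral_mono fun R => ?_
          rw [← Finset.mul_sum, mul_left_comm]
          gcongr
          have := ENNReal.rpow_sum_le_const_mul_sum_rpow Finset.univ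
            (fun i : Fin N => ν {x | x ∈ cube o R ∧ 2⁻¹ * R ≤ |x i - o i|}) one_le_two
          rw [show (2 : ℝ) - 1 = 1 by norm_num, ENNReal.rpow_one, Finset.card_univ,
            Fintype.card_fin] at this
          simpa only [ENNReal.rpow_two] using this
      _ = N * ∑ i, ∫⁻ R in Ioi (0 : ℝ), ENNReal.ofReal (R ^ (-(μ + 1))) *
          ν {x | x ∈ cube o R ∧ 2⁻¹ * R ≤ |x i - o i|} ^ 2 := by
          rw [lintegral_const_mul' _ _ (ENNReal.natCast_ne_top N),
            lintegral_finsetSum _ fun i _ => hsm i]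
      _ ≤ N * ∑ i, C₁ * sideBallEnergy μ ν o i := by
          gcongr with i
          exact h₁ ν o i
      _ = _ := by rw [← Finset.mul_sum, mul_assoc]
  refine hA.trans ?_
  rw [add_mul, one_mul, mul_assoc C₃]
  exact add_le_add_left (mul_le_mul_right hB _) _

/-- Twice the mutual energy of the two sides of a hyperplane, together with the contribution of the
balls avoiding the hyperplane, is at most the sum of the energies of the sides. -/
theorem two_mul_mutual_add_sideBallEnergy_le {N : ℕ} {μ : ℝ} (ν : Measure (Space N)) [SFinite ν]
    (o : Space N) (i : Fin N) :
    2 * (∫⁻ R in Ioi (0 : ℝ), ENNReal.ofReal (R ^ (-(μ + N + 1))) *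
        ∫⁻ z, ν.restrict {x | o i < x i} (ball z R) * ν.restrict {x | x i < o i} (ball z R)) +
      sideBallEnergy μ ν o i ≤
    (∫⁻ R in Ioi (0 : ℝ), ENNReal.ofReal (R ^ (-(μ + N + 1))) *
        ∫⁻ z, ν.restrict {x | o i < x i} (ball z R) * ν.restrict {x | o i < x i} (ball z R)) +
      ∫⁻ R in Ioi (0 : ℝ), ENNReal.ofReal (R ^ (-(μ + N + 1))) *
        ∫⁻ z, ν.restrict {x | x i < o i} (ball z R) * ν.restrict {x | x i < o i} (ball z R) := by
  set P := ν.restrict {x : Space N | o i < x i} with hP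
  set M := ν.restrict {x : Space N | x i < o i} with hM
  have hmeas : ∀ (ν₁ ν₂ : Measure (Space N)) [SFinite ν₁] [SFinite ν₂],
      Measurable fun R => ENNReal.ofReal (R ^ (-(μ + N + 1))) *
        ∫⁻ z, ν₁ (ball z R) * ν₂ (ball z R) := fun ν₁ ν₂ _ _ =>
    Measurable.mul (by fun_prop) (Measurable.lintegral_prod_right'
      ((measurable_measure_ball ν₁).mul (measurable_measure_ball ν₂)))
  rw [sideBallEnergy, ← lintegral_const_mul _ (hmeas P M), ← lintegral_add_left
    ((hmeas P M).const_mul 2), ← lintegral_add_left (hmeas P P)]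
  refine lintegral_mono fun R => ?_
  rw [mul_left_comm, ← mul_add, ← mul_add]
  refine mul_le_mul_right ?_ _
  have hb : ∀ (ν₁ ν₂ : Measure (Space N)) [SFinite ν₁] [SFinite ν₂],
      Measurable fun z => ν₁ (ball z R) * ν₂ (ball z R) := fun ν₁ ν₂ _ _ =>
    (measurable_measure_ball_right ν₁ R).mul (measurable_measure_ball_right ν₂ R)
  rw [← lintegral_const_mul _ (hb P M), ← lintegral_indicator
    (measurableSet_coord o i R), ← lintegral_add_left ((hb P M).const_mul 2),
    ← lintegral_add_left (hb P P)]
  refine lintegral_mono fun z => ?_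
  by_cases hz : R ≤ |z i - o i|
  · rw [indicator_of_mem (by exact hz)]
    have hPM : (P (ball z R) = ν (ball z R) ∧ M (ball z R) = 0) ∨
        (P (ball z R) = 0 ∧ M (ball z R) = ν (ball z R)) := by
      rw [hP, hM, Measure.restrict_apply measurableSet_ball,
        Measure.restrict_apply measurableSet_ball]
      rcases le_abs.mp hz with h | h
      · left
        have h1 : ∀ x ∈ ball z R, o i < x i := fun x hx => by
          have := abs_lt.mp (abs_coord_sub_lt hx i); linarith
        refine ⟨by rw [inter_eq_left.mpr (show ball z R ⊆ {x | o i < x i} from h1)], ?_⟩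
        have : ball z R ∩ {x | x i < o i} = ∅ :=
          eq_empty_of_forall_notMem fun x hx => lt_asymm (h1 x hx.1) hx.2
        rw [this, measure_empty]
      · right
        have h1 : ∀ x ∈ ball z R, x i < o i := fun x hx => by
          have := abs_lt.mp (abs_coord_sub_lt hx i); linarith
        refine ⟨?_, by rw [inter_eq_left.mpr (show ball z R ⊆ {x | x i < o i} from h1)]⟩
        have : ball z R ∩ {x | o i < x i} = ∅ :=
          eq_empty_of_forall_notMem fun x hx => lt_asymm (h1 x hx.1) hx.2
        rw [this, measure_empty]
    rcases hPM with ⟨h1, h2⟩ | ⟨h1, h2⟩ <;> rw [h1, h2] <;> simp [sq]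
  · rw [indicator_of_notMem (by exact hz), add_zero]
    generalize P (ball z R) = a
    generalize M (ball z R) = b
    rcases eq_or_ne a ⊤ with rfl | ha
    · simp
    rcases eq_or_ne b ⊤ with rfl | hb'
    · simp
    lift a to NNReal using ha
    lift b to NNReal using hb'
    have : 2 * (a * b) ≤ a * a + b * b := by
      rw [← NNReal.coe_le_coe]
      push_cast
      nlinarith [sq_nonneg ((a : ℝ) - b)]
    calc 2 * ((a : ℝ≥0∞) * b) = ((2 * (a * b) : NNReal) : ℝ≥0∞) := by push_cast; rfl
      _ ≤ ((a * a + b * b : NNReal) : ℝ≥0∞) := ENNReal.coe_le_coe.mpr this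
      _ = _ := by push_cast; rfl

/-- Through every point there is a coordinate hyperplane for which the mutual energy of the two
sides falls short of the mean of their energies by a fixed proportion of the total energy. -/
theorem exists_half_energy_gap {N : ℕ} (hN : 0 < N) {μ : ℝ} (hμ : 0 < μ) :
    ∃ δ : ℝ≥0∞, δ ≠ 0 ∧ δ ≠ ⊤ ∧ ∀ (ν : Measure (Space N)) [SFinite ν] [NullSingletonClass ν],
      rieszEnergy μ ν ν ≠ ⊤ → ∀ o : Space N, ∃ i : Fin N,
        2 * rieszEnergy μ (ν.restrict {x | o i < x i}) (ν.restrict {x | x i < o i}) +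
          δ * rieszEnergy μ ν ν ≤
        rieszEnergy μ (ν.restrict {x | o i < x i}) (ν.restrict {x | o i < x i}) +
          rieszEnergy μ (ν.restrict {x | x i < o i}) (ν.restrict {x | x i < o i}) := by
  obtain ⟨c, hc0, hct, hc⟩ := exists_rieszEnergy_eq hN hμ
  obtain ⟨C, hC, h⟩ := exists_ballEnergy_le_sum_sideBallEnergy (N := N) hμ
  have hNC : (C + 1) * N ≠ ⊤ := ENNReal.mul_ne_top (ENNReal.add_ne_top.mpr
    ⟨hC, ENNReal.one_ne_top⟩) (ENNReal.natCast_ne_top N)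
  have hNC0 : (C + 1) * N ≠ 0 := mul_ne_zero (by simp) (by exact_mod_cast hN.ne')
  refine ⟨((C + 1) * N)⁻¹, ENNReal.inv_ne_zero.mpr hNC, ENNReal.inv_ne_top.mpr hNC0,
    fun ν _ _ hfin o => ?_⟩
  have h1 := h ν o (by rw [← hc]; exact ENNReal.mul_ne_top hct hfin)
  rw [← hc] at h1
  have : Nonempty (Fin N) := ⟨⟨0, hN⟩⟩
  obtain ⟨i, hi⟩ := Finite.exists_max (sideBallEnergy μ ν o)
  refine ⟨i, ?_⟩
  have h2 : c * rieszEnergy μ ν ν ≤ (C + 1) * N * sideBallEnergy μ ν o i := by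
    refine h1.trans ?_
    rw [mul_assoc]
    refine mul_le_mul' le_self_add ?_
    refine (Finset.sum_le_sum fun j _ => hi j).trans ?_
    simp
  have h3 : c * (((C + 1) * N)⁻¹ * rieszEnergy μ ν ν) ≤ sideBallEnergy μ ν o i := by
    rw [mul_left_comm]
    refine (mul_le_mul_right h2 _).trans ?_
    rw [← mul_assoc, ENNReal.inv_mul_cancel hNC0 hNC, one_mul]
  have h4 := two_mul_mutual_add_sideBallEnergy_le (μ := μ) ν o i
  rw [← hc, ← hc, ← hc] at h4
  refine (ENNReal.mul_le_mul_iff_right hc0 hct).mp ?_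
  rw [mul_add, mul_add, mul_left_comm]
  exact (add_le_add_right h3 _).trans h4

/-! ### The Hardy–Littlewood–Sobolev inequality -/

theorem lintegral_radial {N : ℕ} (h : ℝ → ℝ≥0∞) (x : Space N) {R : ℝ} (hR : 0 < R) :
    ∫⁻ y, h (R⁻¹ * ‖x - y‖) = ENNReal.ofReal (R ^ (N : ℝ)) * ∫⁻ y : Space N, h ‖y‖ := by
  rw [lintegral_sub_left_eq_self (fun y : Space N => h (R⁻¹ * ‖y‖)) x]
  have := lintegral_comp_smul_eq (volume : Measure (Space N)) (fun y => h ‖y‖) (inv_pos.mpr hR)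
  rw [finrank_euclideanSpace, Fintype.card_fin, Real.inv_rpow hR.le, Real.rpow_neg hR.le,
    inv_inv] at this
  rw [← this]
  congr 1; ext y
  rw [norm_smul, Real.norm_of_nonneg (inv_nonneg.mpr hR.le)]

theorem exists_lintegral_ball_rpow_le {N : ℕ} (hN : 0 < N) {μ : ℝ} (hμN : μ < N) :
    ∃ C : ℝ≥0∞, C ≠ ⊤ ∧ ∀ (x : Space N) {R : ℝ}, 0 < R →
      ∫⁻ y in {y | ‖x - y‖ < R}, ENNReal.ofReal (‖x - y‖ ^ (-μ)) ≤
        C * ENNReal.ofReal (R ^ (N - μ)) := by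
  set h : ℝ → ℝ≥0∞ := (Iio 1).indicator fun t => ENNReal.ofReal (t ^ (-μ)) with hh
  have hfin : ∫⁻ y : Space N, h ‖y‖ ≠ ⊤ := by
    have hint : IntegrableOn (fun y : Space N => ‖y‖ ^ (-μ)) (ball 0 1) := by
      refine integrableOn_ball_of_norm_le_rpow (C := 1) (α := μ) ?_ ?_ ?_ ?_
      · rw [finrank_euclideanSpace, Fintype.card_fin]; exact hN
      · rw [finrank_euclideanSpace, Fintype.card_fin]; exact hμN
      · refine Eventually.of_forall fun y => ?_
        rw [one_mul, Real.norm_of_nonneg (by positivity)]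
      · exact (by fun_prop : Measurable fun y : Space N => ‖y‖ ^ (-μ)).aestronglyMeasurable
    refine (lt_of_le_of_lt ?_ hint.2).ne
    rw [← lintegral_indicator measurableSet_ball]
    refine lintegral_mono fun y => ?_
    by_cases hy : ‖y‖ < 1
    · rw [hh, indicator_of_mem (by exact hy), indicator_of_mem (by simpa using hy)]
      exact Real.ofReal_le_enorm _
    · rw [hh, indicator_of_notMem (by exact hy)]
      exact zero_le
  refine ⟨∫⁻ y : Space N, h ‖y‖, hfin, fun x R hR => ?_⟩
  have hm : MeasurableSet {y : Space N | ‖x - y‖ < R} :=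
    (isOpen_lt (by fun_prop) (by fun_prop)).measurableSet
  have e : ∀ y : Space N, {y : Space N | ‖x - y‖ < R}.indicator
      (fun y => ENNReal.ofReal (‖x - y‖ ^ (-μ))) y =
      ENNReal.ofReal (R ^ (-μ)) * h (R⁻¹ * ‖x - y‖) := by
    intro y
    by_cases hy : ‖x - y‖ < R
    · rw [indicator_of_mem (by exact hy), hh, indicator_of_mem (by
        rw [mem_Iio, inv_mul_lt_iff₀ hR, mul_one]; exact hy), ← ENNReal.ofReal_mul (by positivity),
        ← Real.mul_rpow hR.le (by positivity), mul_inv_cancel_left₀ hR.ne']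
    · rw [indicator_of_notMem (by exact hy), hh, indicator_of_notMem (by
        rw [mem_Iio, inv_mul_lt_iff₀ hR, mul_one]; exact hy), mul_zero]
  rw [← lintegral_indicator hm]
  simp_rw [e]
  rw [lintegral_const_mul' _ _ ENNReal.ofReal_ne_top, lintegral_radial h x hR, ← mul_assoc,
    ← ENNReal.ofReal_mul (by positivity), ← Real.rpow_add hR, mul_comm]
  rw [show -μ + N = N - μ by ring]

theorem exists_lintegral_compl_ball_rpow_le {N : ℕ} (hN : 0 < N) :
    ∃ C : ℝ≥0∞, C ≠ ⊤ ∧ ∀ (x : Space N) {R : ℝ}, 0 < R →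
      ∫⁻ y in {y | R ≤ ‖x - y‖}, ENNReal.ofReal (‖x - y‖ ^ (-(2 * N : ℝ))) ≤
        C * ENNReal.ofReal (R ^ (-(N : ℝ))) := by
  set h : ℝ → ℝ≥0∞ := (Ici 1).indicator fun t => ENNReal.ofReal (t ^ (-(2 * N : ℝ))) with hh
  have hfin : ∫⁻ y : Space N, h ‖y‖ ≠ ⊤ := by
    have hN' : (0 : ℝ) < N := Nat.cast_pos.mpr hN
    have hint := finite_integral_one_add_norm (E := Space N) (r := 2 * N) (μ := volume)
      (by rw [finrank_euclideanSpace, Fintype.card_fin]; linarith)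
    refine (lt_of_le_of_lt ?_ (ENNReal.mul_lt_top
      (ENNReal.ofReal_lt_top (r := 2 ^ (2 * N : ℝ))) hint)).ne
    rw [← lintegral_const_mul' _ _ ENNReal.ofReal_ne_top]
    refine lintegral_mono fun y => ?_
    by_cases hy : 1 ≤ ‖y‖
    · rw [hh, indicator_of_mem (by exact hy), ← ENNReal.ofReal_mul (by positivity)]
      refine ENNReal.ofReal_le_ofReal ?_
      have h1 : (‖y‖ : ℝ) ^ (-(2 * N : ℝ)) ≤ ((1 + ‖y‖) / 2) ^ (-(2 * N : ℝ)) :=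
        Real.rpow_le_rpow_of_nonpos (by positivity) (by linarith) (by linarith)
      refine h1.trans (le_of_eq ?_)
      rw [Real.div_rpow (by positivity) (by norm_num), Real.rpow_neg (by norm_num : (0 : ℝ) ≤ 2),
        div_inv_eq_mul, mul_comm]
    · rw [hh, indicator_of_notMem (by exact hy)]
      exact zero_le
  refine ⟨∫⁻ y : Space N, h ‖y‖, hfin, fun x R hR => ?_⟩
  have hm : MeasurableSet {y : Space N | R ≤ ‖x - y‖} :=
    (isClosed_le (by fun_prop) (by fun_prop)).measurableSet
  have e : ∀ y : Space N, {y : Space N | R ≤ ‖x - y‖}.indicator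
      (fun y => ENNReal.ofReal (‖x - y‖ ^ (-(2 * N : ℝ)))) y =
      ENNReal.ofReal (R ^ (-(2 * N : ℝ))) * h (R⁻¹ * ‖x - y‖) := by
    intro y
    by_cases hy : R ≤ ‖x - y‖
    · rw [indicator_of_mem (by exact hy), hh, indicator_of_mem (by
        rw [mem_Ici, le_inv_mul_iff₀ hR, mul_one]; exact hy), ← ENNReal.ofReal_mul (by positivity),
        ← Real.mul_rpow hR.le (by positivity), mul_inv_cancel_left₀ hR.ne']
    · rw [indicator_of_notMem (by exact hy), hh, indicator_of_notMem (by
        rw [mem_Ici, le_inv_mul_iff₀ hR, mul_one]; exact hy), mul_zero]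
  rw [← lintegral_indicator hm]
  simp_rw [e]
  rw [lintegral_const_mul' _ _ ENNReal.ofReal_ne_top, lintegral_radial h x hR, ← mul_assoc,
    ← ENNReal.ofReal_mul (by positivity), ← Real.rpow_add hR, mul_comm]
  rw [show -(2 * N : ℝ) + N = -N by ring]

/-- The radius at which the near and the far part of the Riesz potential balance. -/
theorem exists_balancing_radius {n μ : ℝ} (hμ0 : 0 < μ) (hμn : μ < n) {a φ : ℝ} (ha : 0 < a)
    (hφ : 0 < φ) :
    ∃ R > 0, φ * (φ * R ^ (n - μ)) = φ ^ (2 * n / (2 * n - μ)) * a ^ (1 - μ / n) ∧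
      φ * (a ^ ((2 * n - μ) / (2 * n)) * R ^ (-(μ / 2))) =
        φ ^ (2 * n / (2 * n - μ)) * a ^ (1 - μ / n) := by
  have hn : 0 < n := hμ0.trans hμn
  have h2 : 2 * n - μ ≠ 0 := by linarith
  refine ⟨a ^ (1 / n) * φ ^ (-(2 / (2 * n - μ))), by positivity, ?_, ?_⟩
  · rw [Real.mul_rpow (by positivity) (by positivity), ← Real.rpow_mul ha.le,
      ← Real.rpow_mul hφ.le]
    nth_rw 1 [← Real.rpow_one φ]
    nth_rw 2 [← Real.rpow_one φ]
    rw [mul_left_comm (φ ^ (1 : ℝ)) (a ^ _), mul_left_comm (φ ^ (1 : ℝ)) (a ^ _),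
      ← Real.rpow_add hφ, ← Real.rpow_add hφ, mul_comm]
    (congr 2 <;> field_simp); ring
  · rw [Real.mul_rpow (by positivity) (by positivity), ← Real.rpow_mul ha.le,
      ← Real.rpow_mul hφ.le, ← mul_assoc (a ^ _), ← Real.rpow_add ha]
    nth_rw 1 [← Real.rpow_one φ]
    rw [mul_left_comm, ← Real.rpow_add hφ, mul_comm]
    congr 2 <;> field_simp <;> ring

/-- The potential at `x` of the part of `f` below the level `f x` is estimated by `f x` inside a
ball about `x` and by Hölder's inequality outside, with an optimal choice of the radius. -/
theorem exists_lintegral_sublevel_le {N : ℕ} {μ : ℝ} (hμ0 : 0 < μ) (hμN : μ < N) :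
    ∃ C : ℝ≥0∞, C ≠ ⊤ ∧ ∀ f : Space N → ℝ≥0∞, Measurable f → (∀ x, f x ≠ ⊤) →
      ∀ a : ℝ, 0 < a → ∫⁻ x, f x ^ (2 * N / (2 * N - μ) : ℝ) = ENNReal.ofReal a → ∀ x,
      ∫⁻ y in {y | f y ≤ f x}, f x * f y * ENNReal.ofReal (‖x - y‖ ^ (-μ)) ≤
        C * (f x ^ (2 * N / (2 * N - μ) : ℝ) * ENNReal.ofReal (a ^ (1 - μ / N))) := by
  have hN' : (0 : ℝ) < N := hμ0.trans hμN
  have hN : 0 < N := by exact_mod_cast hN'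
  obtain ⟨C₁, hC₁, h₁⟩ := exists_lintegral_ball_rpow_le hN hμN
  obtain ⟨C₂, hC₂, h₂⟩ := exists_lintegral_compl_ball_rpow_le hN
  set C₃ := C₂ ^ (μ / (2 * N)) with hC₃
  have hC₃t : C₃ ≠ ⊤ := ENNReal.rpow_ne_top_of_nonneg (by positivity) hC₂
  refine ⟨C₁ + C₃, ENNReal.add_ne_top.mpr ⟨hC₁, hC₃t⟩, fun f hf hft a ha0 hA x => ?_⟩
  set r : ℝ := 2 * N / (2 * N - μ) with hr
  have h2 : 0 < 2 * N - μ := by linarith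
  have hr0 : 0 < r := by positivity
  rcases eq_or_ne (f x) 0 with hx0 | hx0
  · simp [hx0]
  set φ := (f x).toReal with hφ
  have hφ0 : 0 < φ := ENNReal.toReal_pos hx0 (hft x)
  have hφf : ENNReal.ofReal φ = f x := ENNReal.ofReal_toReal (hft x)
  obtain ⟨R, hR, hR1, hR2⟩ := exists_balancing_radius hμ0 hμN ha0 hφ0
  have hkx : Measurable fun y => ENNReal.ofReal (‖x - y‖ ^ (-μ)) := by fun_prop
  have hnear : ∫⁻ y in {y | f y ≤ f x} ∩ {y | ‖x - y‖ < R}, f y * ENNReal.ofReal (‖x - y‖ ^ (-μ)) ≤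
      f x * (C₁ * ENNReal.ofReal (R ^ (N - μ))) := by
    calc _ ≤ ∫⁻ y in {y | f y ≤ f x} ∩ {y | ‖x - y‖ < R}, f x * ENNReal.ofReal (‖x - y‖ ^ (-μ)) := by
          refine setLIntegral_mono' ((measurableSet_le hf measurable_const).inter
            (isOpen_lt (by fun_prop) (by fun_prop)).measurableSet) fun y hy => ?_
          exact mul_le_mul_left hy.1 _
      _ ≤ ∫⁻ y in {y | ‖x - y‖ < R}, f x * ENNReal.ofReal (‖x - y‖ ^ (-μ)) := lintegral_mono_set inter_subset_right
      _ = f x * ∫⁻ y in {y | ‖x - y‖ < R}, ENNReal.ofReal (‖x - y‖ ^ (-μ)) := lintegral_const_mul' _ _ (hft x)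
      _ ≤ _ := mul_le_mul_right (h₁ x hR) _
  have hconj : r.HolderConjugate (2 * N / μ) := by
    rw [Real.holderConjugate_iff]
    refine ⟨?_, ?_⟩
    · rw [hr, lt_div_iff₀ h2]; linarith
    · rw [hr]; field_simp; ring
  have hfar : ∫⁻ y in {y | R ≤ ‖x - y‖}, f y * ENNReal.ofReal (‖x - y‖ ^ (-μ)) ≤
      ENNReal.ofReal (a ^ ((2 * N - μ) / (2 * N))) * (C₃ * ENNReal.ofReal (R ^ (-(μ / 2)))) := by
    refine (ENNReal.lintegral_mul_le_Lp_mul_Lq _ hconj hf.aemeasurable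
      hkx.aemeasurable).trans ?_
    refine mul_le_mul' ?_ ?_
    · rw [← ENNReal.ofReal_rpow_of_pos ha0, ← hA, hr, one_div_div]
      exact ENNReal.rpow_le_rpow (setLIntegral_le_lintegral _ _) (by positivity)
    · have e : ∀ y, ENNReal.ofReal (‖x - y‖ ^ (-μ)) ^ (2 * N / μ) = ENNReal.ofReal (‖x - y‖ ^ (-(2 * N : ℝ))) := by
        intro y
        rw [ENNReal.ofReal_rpow_of_nonneg (by positivity) (by positivity),
          ← Real.rpow_mul (norm_nonneg _)]
        congr 2; field_simp
      simp_rw [e]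
      refine (ENNReal.rpow_le_rpow (h₂ x hR) (by positivity)).trans (le_of_eq ?_)
      rw [one_div_div, ENNReal.mul_rpow_of_nonneg _ _ (by positivity),
        ENNReal.ofReal_rpow_of_nonneg (by positivity) (by positivity), ← Real.rpow_mul hR.le]
      congr 3; field_simp
  have hsplit : ∫⁻ y in {y | f y ≤ f x}, f y * ENNReal.ofReal (‖x - y‖ ^ (-μ)) ≤
      f x * (C₁ * ENNReal.ofReal (R ^ (N - μ))) +
      ENNReal.ofReal (a ^ ((2 * N - μ) / (2 * N))) * (C₃ * ENNReal.ofReal (R ^ (-(μ / 2)))) := by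
    have hsub : {y | f y ≤ f x} ⊆ ({y | f y ≤ f x} ∩ {y | ‖x - y‖ < R}) ∪ {y | R ≤ ‖x - y‖} := by
      intro y hy
      rcases lt_or_ge ‖x - y‖ R with h | h
      · exact Or.inl ⟨hy, h⟩
      · exact Or.inr h
    exact (lintegral_mono_set hsub).trans
      ((lintegral_union_le _ _ _).trans (add_le_add hnear hfar))
  simp_rw [mul_assoc]
  rw [lintegral_const_mul' _ _ (hft x)]
  refine (mul_le_mul_right hsplit _).trans (le_of_eq ?_)
  have e1 : f x * (f x * ENNReal.ofReal (R ^ (N - μ))) =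
      f x ^ r * ENNReal.ofReal (a ^ (1 - μ / N)) := by
    rw [← hφf, ENNReal.ofReal_rpow_of_pos hφ0, ← ENNReal.ofReal_mul (by positivity),
      ← ENNReal.ofReal_mul (by positivity), ← ENNReal.ofReal_mul (by positivity), hR1]
  have e2 : f x * (ENNReal.ofReal (a ^ ((2 * N - μ) / (2 * N))) *
      ENNReal.ofReal (R ^ (-(μ / 2)))) = f x ^ r * ENNReal.ofReal (a ^ (1 - μ / N)) := by
    rw [← hφf, ENNReal.ofReal_rpow_of_pos hφ0, ← ENNReal.ofReal_mul (by positivity),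
      ← ENNReal.ofReal_mul (by positivity), ← ENNReal.ofReal_mul (by positivity), hR2]
  calc _ = C₁ * (f x * (f x * ENNReal.ofReal (R ^ (N - μ)))) +
        C₃ * (f x * (ENNReal.ofReal (a ^ ((2 * N - μ) / (2 * N))) *
          ENNReal.ofReal (R ^ (-(μ / 2))))) := by ring
    _ = _ := by rw [e1, e2]; ring

/-- The Hardy–Littlewood–Sobolev inequality on the diagonal; by symmetry only pairs with
`f y ≤ f x` matter. -/
theorem exists_hls {N : ℕ} {μ : ℝ} (hμ0 : 0 < μ) (hμN : μ < N) :
    ∃ C : ℝ≥0∞, C ≠ ⊤ ∧ ∀ f : Space N → ℝ≥0∞, Measurable f → (∀ x, f x ≠ ⊤) →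
      ∫⁻ x, ∫⁻ y, f x * f y * ENNReal.ofReal (‖x - y‖ ^ (-μ)) ≤
        C * (∫⁻ x, f x ^ (2 * N / (2 * N - μ) : ℝ)) ^ ((2 * N - μ) / N : ℝ) := by
  have hN' : (0 : ℝ) < N := hμ0.trans hμN
  have hN : 0 < N := by exact_mod_cast hN'
  obtain ⟨C₁, hC₁, h₁⟩ := exists_lintegral_sublevel_le hμ0 hμN
  have hC : 2 * C₁ + 1 ≠ ⊤ := by
    exact ENNReal.add_ne_top.mpr ⟨ENNReal.mul_ne_top (by simp) hC₁, ENNReal.one_ne_top⟩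
  refine ⟨2 * C₁ + 1, hC, fun f hf hft => ?_⟩
  set r : ℝ := 2 * N / (2 * N - μ) with hr
  have h2 : 0 < 2 * N - μ := by linarith
  have hr0 : 0 < r := by positivity
  set A := ∫⁻ x, f x ^ r with hA
  set k : Space N → Space N → ℝ≥0∞ := fun x y => ENNReal.ofReal (‖x - y‖ ^ (-μ)) with hk
  have hkm : Measurable fun q : Space N × Space N => k q.1 q.2 := by fun_prop
  rcases eq_or_ne A 0 with hA0 | hA0
  · have hf0 : ∀ᵐ x, f x = 0 := by
      filter_upwards [(lintegral_eq_zero_iff (hf.pow_const r)).mp hA0] with x hx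
      simpa [hr0, hr0.not_gt] using hx
    have : ∫⁻ x, ∫⁻ y, f x * f y * k x y = 0 := by
      rw [← lintegral_zero (μ := (volume : Measure (Space N)))]
      refine lintegral_congr_ae ?_
      filter_upwards [hf0] with x hx
      simp [hx]
    rw [this]
    exact zero_le
  rcases eq_or_ne A ⊤ with hAt | hAt
  · rw [hAt, ENNReal.top_rpow_of_pos (by positivity), ENNReal.mul_top (by simp)]
    exact le_top
  set a := A.toReal with ha
  have ha0 : 0 < a := ENNReal.toReal_pos hA0 hAt
  have haA : ENNReal.ofReal a = A := ENNReal.ofReal_toReal hAt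
  set g : Space N → Space N → ℝ≥0∞ := fun x y => {y | f y ≤ f x}.indicator
    (fun y => f x * f y * k x y) y with hg
  have hsetm : MeasurableSet {q : Space N × Space N | f q.2 ≤ f q.1} :=
    measurableSet_le (hf.comp measurable_snd) (hf.comp measurable_fst)
  have hgm : Measurable fun q : Space N × Space N => g q.1 q.2 := by
    have : (fun q : Space N × Space N => g q.1 q.2) = {q | f q.2 ≤ f q.1}.indicator
        (fun q => f q.1 * f q.2 * k q.1 q.2) := by
      ext q; rfl
    rw [this]
    exact (((hf.comp measurable_fst).mul (hf.comp measurable_snd)).mul hkm).indicator hsetm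
  have hle : ∀ x y, f x * f y * k x y ≤ g x y + g y x := by
    intro x y
    rcases le_total (f y) (f x) with h | h
    · rw [hg]; simp only
      rw [indicator_of_mem (by exact h)]
      exact le_self_add
    · rw [hg]; simp only
      rw [indicator_of_mem (s := {z | f z ≤ f y}) (by exact h), mul_comm (f y),
        show k y x = k x y by simp only [hk, norm_sub_rev]]
      exact le_add_self
  have hgx : ∀ x, ∫⁻ y, g x y = ∫⁻ y in {y | f y ≤ f x}, f x * f y * k x y := fun x =>
    lintegral_indicator (measurableSet_le hf measurable_const) _
  calc _ ≤ ∫⁻ x, ∫⁻ y, (g x y + g y x) := lintegral_mono fun x => lintegral_mono fun y => hle x y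
    _ = (∫⁻ x, ∫⁻ y, g x y) + ∫⁻ x, ∫⁻ y, g y x := by
        rw [← lintegral_add_left hgm.lintegral_prod_right']
        refine lintegral_congr fun x => ?_
        exact lintegral_add_left (f := g x) (hgm.comp (measurable_prodMk_left (x := x))) _
    _ = 2 * ∫⁻ x, ∫⁻ y, g x y := by
        rw [lintegral_lintegral_swap (f := fun x y => g y x)
          (hgm.comp measurable_swap).aemeasurable, two_mul]
    _ ≤ 2 * ∫⁻ x, C₁ * (f x ^ r * ENNReal.ofReal (a ^ (1 - μ / N))) := by
        refine mul_le_mul_right (lintegral_mono fun x => ?_) _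
        rw [hgx]
        exact h₁ f hf hft a ha0 haA.symm x
    _ = 2 * C₁ * (A * ENNReal.ofReal (a ^ (1 - μ / N))) := by
        rw [lintegral_const_mul' _ _ hC₁,
          lintegral_mul_const' _ _ ENNReal.ofReal_ne_top, mul_assoc]
    _ = 2 * C₁ * A ^ ((2 * N - μ) / N) := by
        rw [← haA, ENNReal.ofReal_rpow_of_pos ha0, ← ENNReal.ofReal_mul ha0.le]
        congr 2
        nth_rw 1 [← Real.rpow_one a]
        rw [← Real.rpow_add ha0]
        congr 1; field_simp; ring
    _ ≤ _ := mul_le_mul_left le_self_add _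

/-! ### The Choquard energy and smooth functions with compact support -/

theorem critExp_pos {N : ℕ} (hN : 4 ≤ N) {μ : ℝ} (hμN : μ < N) : 0 < critExp N μ := by
  have : (4 : ℝ) ≤ N := by exact_mod_cast hN
  exact div_pos (by linarith) (by linarith)

theorem choquardEnergy_eq {N : ℕ} (μ : ℝ) (Ω : Set (Space N)) (u : Space N → ℝ) :
    choquardEnergy μ Ω u = ∫⁻ x in Ω, ∫⁻ y in Ω, ENNReal.ofReal (|u x| ^ critExp N μ) *
      ENNReal.ofReal (|u y| ^ critExp N μ) * ENNReal.ofReal (‖x - y‖ ^ (-μ)) := by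
  unfold choquardEnergy
  refine lintegral_congr fun x => lintegral_congr fun y => ?_
  rw [div_eq_mul_inv, ← Real.rpow_neg (norm_nonneg _), ENNReal.ofReal_mul (by positivity),
    ENNReal.ofReal_mul (by positivity)]

theorem choquardEnergy_mono {N : ℕ} (μ : ℝ) {Ω Ω' : Set (Space N)} (h : Ω ⊆ Ω')
    (u : Space N → ℝ) : choquardEnergy μ Ω u ≤ choquardEnergy μ Ω' u :=
  (lintegral_mono fun _ => lintegral_mono_set h).trans (lintegral_mono_set h)

/-- The measure `|u| ^ (2*_μ) dx`. -/
noncomputable def choquardMeasure {N : ℕ} (μ : ℝ) (u : Space N → ℝ) : Measure (Space N) :=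
  volume.withDensity fun x => ENNReal.ofReal (|u x| ^ critExp N μ)

theorem rieszEnergy_choquardMeasure {N : ℕ} (μ : ℝ) {A B : Set (Space N)} (hA : MeasurableSet A)
    (hB : MeasurableSet B) {u : Space N → ℝ} (hu : Continuous u) :
    rieszEnergy μ ((choquardMeasure μ u).restrict A) ((choquardMeasure μ u).restrict B) =
      ∫⁻ x in A, ∫⁻ y in B, ENNReal.ofReal (|u x| ^ critExp N μ) *
      ENNReal.ofReal (|u y| ^ critExp N μ) * ENNReal.ofReal (‖x - y‖ ^ (-μ)) := by
  have hum := hu.measurable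
  have hF : Measurable fun x => ENNReal.ofReal (|u x| ^ critExp N μ) := by fun_prop
  have hk : Measurable fun q : Space N × Space N => ENNReal.ofReal (‖q.1 - q.2‖ ^ (-μ)) := by
    fun_prop
  rw [choquardMeasure, restrict_withDensity hA, restrict_withDensity hB, rieszEnergy]
  have h1 : ∀ x, ∫⁻ y, ENNReal.ofReal (‖x - y‖ ^ (-μ)) ∂((volume.restrict B).withDensity
      fun x => ENNReal.ofReal (|u x| ^ critExp N μ)) = ∫⁻ y in B,
        ENNReal.ofReal (|u y| ^ critExp N μ) * ENNReal.ofReal (‖x - y‖ ^ (-μ)) := by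
    intro x
    rw [lintegral_withDensity_eq_lintegral_mul _ hF (by fun_prop)]
    rfl
  simp_rw [h1]
  rw [lintegral_withDensity_eq_lintegral_mul _ hF]
  · refine lintegral_congr fun x => ?_
    simp_rw [mul_assoc]
    rw [Pi.mul_apply, lintegral_const_mul' _ _ ENNReal.ofReal_ne_top]
  · exact Measurable.lintegral_prod_right' (f := fun q : Space N × Space N =>
      ENNReal.ofReal (|u q.2| ^ critExp N μ) * ENNReal.ofReal (‖q.1 - q.2‖ ^ (-μ)))
      ((hF.comp measurable_snd).mul hk)

theorem norm_gradient {N : ℕ} (φ : Space N → ℝ) (x : Space N) : ‖∇ φ x‖ = ‖fderiv ℝ φ x‖ := by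
  simp [gradient]

theorem enorm_gradient {N : ℕ} (φ : Space N → ℝ) (x : Space N) : ‖∇ φ x‖ₑ = ‖fderiv ℝ φ x‖ₑ := by
  rw [← ofReal_norm, ← ofReal_norm, norm_gradient]

theorem continuous_gradient {N : ℕ} {φ : Space N → ℝ} (hφ : ContDiff ℝ ∞ φ) :
    Continuous (∇ φ) :=
  (InnerProductSpace.toDual ℝ (Space N)).symm.continuous.comp
    (hφ.continuous_fderiv (by simp))

theorem hasCompactSupport_gradient {N : ℕ} {φ : Space N → ℝ} (hc : HasCompactSupport φ) :
    HasCompactSupport (∇ φ) :=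
  (hc.fderiv ℝ).comp_left (g := (InnerProductSpace.toDual ℝ (Space N)).symm) (map_zero _)

theorem isH1_of_contDiff {N : ℕ} (Ω : Set (Space N)) {φ : Space N → ℝ} (hφ : ContDiff ℝ ∞ φ)
    (hc : HasCompactSupport φ) : IsH1 Ω φ (∇ φ) where
  memLp := (hφ.continuous.memLp_of_hasCompactSupport hc).restrict Ω
  memLp_grad := ((continuous_gradient hφ).memLp_of_hasCompactSupport
    (hasCompactSupport_gradient hc)).restrict Ω
  weak_grad := by
    intro ψ hψ v
    have hψ0 : ∀ x, x ∉ Ω → ψ x = 0 := fun x hx =>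
      image_eq_zero_of_notMem_tsupport fun h => hx (hψ.tsupport_subset h)
    have hψ1 : ∀ x, x ∉ Ω → fderiv ℝ ψ x = 0 := fun x hx =>
      image_eq_zero_of_notMem_tsupport fun h =>
        hx (hψ.tsupport_subset (tsupport_fderiv_subset ℝ h))
    have hψc := hψ.contDiff.continuous
    have hφc := hφ.continuous
    have hψ' : Continuous fun x => fderiv ℝ ψ x v :=
      (hψ.contDiff.continuous_fderiv (by simp)).clm_apply continuous_const
    have hφ' : Continuous fun x => fderiv ℝ φ x v :=
      (hφ.continuous_fderiv (by simp)).clm_apply continuous_const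
    rw [setIntegral_eq_integral_of_forall_compl_eq_zero (fun x hx => by simp [hψ1 x hx]),
      setIntegral_eq_integral_of_forall_compl_eq_zero (fun x hx => by simp [hψ0 x hx])]
    have h := integral_mul_fderiv_eq_neg_fderiv_mul_of_integrable (𝕜 := ℝ) (μ := volume)
      (f := φ) (g := ψ) (v := v)
      ((hφ'.mul hψc).integrable_of_hasCompactSupport hψ.hasCompactSupport.mul_left)
      ((hφc.mul hψ').integrable_of_hasCompactSupport hc.mul_right)
      ((hφc.mul hψc).integrable_of_hasCompactSupport hc.mul_right)
      (fun x _ => hφ.differentiable (by simp) x)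
      (fun x _ => hψ.contDiff.differentiable (by simp) x)
    rw [h]
    simp [gradient]

theorem IsTestFunction.isH10 {N : ℕ} {Ω : Set (Space N)} {φ : Space N → ℝ}
    (h : IsTestFunction Ω φ) : IsH10 Ω φ (∇ φ) where
  toIsH1 := isH1_of_contDiff Ω h.contDiff h.hasCompactSupport
  approx := ⟨fun _ => φ, fun _ => h, by simp, by simp⟩

/-- The Sobolev inequality combined with the Hardy–Littlewood–Sobolev inequality. -/
theorem exists_choquardEnergy_le {N : ℕ} (hN : 4 ≤ N) {μ : ℝ} (hμ0 : 0 < μ) (hμN : μ < N) :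
    ∃ C : ℝ≥0∞, C ≠ ⊤ ∧ ∀ φ : Space N → ℝ, ContDiff ℝ ∞ φ → HasCompactSupport φ →
      choquardEnergy μ univ φ ≤ C * (∫⁻ x, ‖∇ φ x‖ₑ ^ 2) ^ critExp N μ := by
  have hN4 : (4 : ℝ) ≤ N := by exact_mod_cast hN
  obtain ⟨C, hC, h⟩ := exists_hls hμ0 hμN
  have hp := critExp_pos hN hμN
  set q : NNReal := ⟨2 * N / (N - 2), div_nonneg (by positivity) (by linarith)⟩ with hq
  have hqv : (q : ℝ) = 2 * N / (N - 2) := rfl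
  have hq1 : 0 ≤ (q : ℝ) := NNReal.coe_nonneg q
  have hq0 : (q : ℝ) ≠ 0 := by rw [hqv]; exact (div_pos (by linarith) (by linarith)).ne'
  set K : ℝ≥0∞ := ((SNormLESNormFDerivOfEqConst ℝ (volume : Measure (Space N)) 2 : NNReal) : ℝ≥0∞) with hK
  refine ⟨C * (K ^ ((2 * N / (N - 2) : ℝ))) ^ ((2 * N - μ) / N : ℝ), ?_, fun φ hφ hc => ?_⟩
  · refine ENNReal.mul_ne_top hC (ENNReal.rpow_ne_top_of_nonneg ?_
      (ENNReal.rpow_ne_top_of_nonneg ?_ ENNReal.coe_ne_top))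
    · exact div_nonneg (by linarith) (by linarith)
    · exact div_nonneg (by linarith) (by linarith)
  have hs := eLpNorm_le_eLpNorm_fderiv_of_eq (volume : Measure (Space N)) (hφ.of_le (by simp)) hc
    (p := 2) (p' := q) (by norm_num) (by
      rw [finrank_euclideanSpace, Fintype.card_fin]; omega) (by
      rw [finrank_euclideanSpace, Fintype.card_fin, hqv]
      have : (N : ℝ) - 2 ≠ 0 := by linarith
      push_cast
      field_simp)
  have hN2 : (N : ℝ) - 2 ≠ 0 := by linarith
  have h2μ : 2 * (N : ℝ) - μ ≠ 0 := by linarith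
  have h1 : ∫⁻ x, ENNReal.ofReal (|φ x| ^ critExp N μ) ^ (2 * N / (2 * N - μ) : ℝ) =
      eLpNorm φ q volume ^ (q : ℝ) := by
    rw [eLpNorm_nnreal_pow_eq_lintegral (by exact_mod_cast hq0)]
    refine lintegral_congr fun x => ?_
    rw [Real.enorm_eq_ofReal_abs, ENNReal.ofReal_rpow_of_nonneg (by positivity)
      (div_nonneg (by positivity) (by linarith)), ← Real.rpow_mul (abs_nonneg _),
      ENNReal.ofReal_rpow_of_nonneg (abs_nonneg _) hq1]
    congr 2
    rw [hqv, critExp]; field_simp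
  have h2 : eLpNorm (fderiv ℝ φ) ((2 : NNReal) : ℝ≥0∞) volume =
      (∫⁻ x, ‖∇ φ x‖ₑ ^ 2) ^ (1 / 2 : ℝ) := by
    have := eLpNorm_nnreal_pow_eq_lintegral (f := fderiv ℝ φ) (μ := (volume : Measure (Space N)))
      (p := 2) two_ne_zero
    simp_rw [enorm_gradient, ← ENNReal.rpow_two]
    rw [show ((2 : NNReal) : ℝ) = 2 from rfl] at this
    rw [← this, ← ENNReal.rpow_mul]
    norm_num
  rw [h2] at hs
  have hm : Measurable fun x => ENNReal.ofReal (|φ x| ^ critExp N μ) := by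
    have := hφ.continuous.measurable
    fun_prop
  have h3 := h (fun x => ENNReal.ofReal (|φ x| ^ critExp N μ)) hm fun x => ENNReal.ofReal_ne_top
  rw [h1] at h3
  rw [choquardEnergy_eq, Measure.restrict_univ]
  have hx0 : 0 ≤ (2 * (N : ℝ) - μ) / N := div_nonneg (by linarith) (by linarith)
  calc _ ≤ _ := h3
    _ ≤ C * ((K * (∫⁻ x, ‖∇ φ x‖ₑ ^ 2) ^ (1 / 2 : ℝ)) ^ (q : ℝ)) ^ ((2 * N - μ) / N : ℝ) :=
        mul_le_mul_right (ENNReal.rpow_le_rpow (ENNReal.rpow_le_rpow hs hq1) hx0) _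
    _ = _ := by
        rw [ENNReal.mul_rpow_of_nonneg _ _ hq1, ENNReal.mul_rpow_of_nonneg _ _ hx0,
          ← ENNReal.rpow_mul (∫⁻ x, ‖∇ φ x‖ₑ ^ 2), ← ENNReal.rpow_mul (∫⁻ x, ‖∇ φ x‖ₑ ^ 2), ← mul_assoc,
          hqv, show 1 / 2 * (2 * N / (N - 2)) * ((2 * N - μ) / N) = critExp N μ by
            rw [critExp]; field_simp]

theorem lintegral_enorm_sq_eq {α E : Type*} [MeasurableSpace α] [NormedAddCommGroup E]
    (m : Measure α) (f : α → E) : ∫⁻ x, ‖f x‖ₑ ^ 2 ∂m = eLpNorm f 2 m ^ (2 : ℝ) := by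
  have := eLpNorm_nnreal_pow_eq_lintegral (f := f) (μ := m) (p := 2) two_ne_zero
  rw [show ((2 : NNReal) : ℝ) = 2 from rfl] at this
  simp_rw [← ENNReal.rpow_two]
  exact this.symm

/-- Fatou's lemma for the Choquard energy. -/
theorem choquardEnergy_le_liminf {N : ℕ} {μ : ℝ} {Ω : Set (Space N)} (hq : 0 < critExp N μ)
    {φ : ℕ → Space N → ℝ} (hφ : ∀ k, Measurable (φ k)) {u : Space N → ℝ}
    (hae : ∀ᵐ x ∂volume.restrict Ω, Tendsto (fun k => φ k x) atTop (𝓝 (u x))) :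
    choquardEnergy μ Ω u ≤ liminf (fun k => choquardEnergy μ Ω (φ k)) atTop := by
  have hjm : ∀ k, Measurable fun q : Space N × Space N =>
      ENNReal.ofReal (|φ k q.1| ^ critExp N μ * |φ k q.2| ^ critExp N μ /
        ‖q.1 - q.2‖ ^ μ) := by
    intro k
    have h1 := hφ k
    fun_prop
  have hjx : ∀ k x, Measurable fun y : Space N =>
      ENNReal.ofReal (|φ k x| ^ critExp N μ * |φ k y| ^ critExp N μ / ‖x - y‖ ^ μ) := by
    intro k x
    have h1 := hφ k
    fun_prop
  calc choquardEnergy μ Ω u = ∫⁻ x in Ω, ∫⁻ y in Ω, liminf (fun k =>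
        ENNReal.ofReal (|φ k x| ^ critExp N μ * |φ k y| ^ critExp N μ /
          ‖x - y‖ ^ μ)) atTop := by
        refine lintegral_congr_ae ?_
        filter_upwards [hae] with x hx
        refine lintegral_congr_ae ?_
        filter_upwards [hae] with y hy
        refine (Tendsto.liminf_eq ?_).symm
        refine ENNReal.tendsto_ofReal (Tendsto.div_const (Tendsto.mul ?_ ?_) _)
        · exact hx.abs.rpow_const (Or.inr hq.le)
        · exact hy.abs.rpow_const (Or.inr hq.le)
    _ ≤ ∫⁻ x in Ω, liminf (fun k => ∫⁻ y in Ω,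
        ENNReal.ofReal (|φ k x| ^ critExp N μ * |φ k y| ^ critExp N μ /
          ‖x - y‖ ^ μ)) atTop := lintegral_mono fun x => lintegral_liminf_le fun k => hjx k x
    _ ≤ _ := lintegral_liminf_le fun k => Measurable.lintegral_prod_right' (hjm k)

/-- An upper bound for the Choquard energy by the Dirichlet energy passes from test functions to
their limits. -/
theorem choquardEnergy_le_of_isH10 {N : ℕ} {μ : ℝ} {Ω : Set (Space N)} {C : ℝ≥0∞} (hC : C ≠ ⊤)
    (hq : 0 < critExp N μ) {p : ℝ} (hp : 0 < p)
    (h : ∀ φ, IsTestFunction Ω φ → choquardEnergy μ Ω φ ≤ C * (∫⁻ x in Ω, ‖∇ φ x‖ₑ ^ 2) ^ p)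
    {u : Space N → ℝ} {G : Space N → Space N} (hu : IsH10 Ω u G) :
    choquardEnergy μ Ω u ≤ C * (∫⁻ x in Ω, ‖G x‖ₑ ^ 2) ^ p := by
  obtain ⟨φ, hφ, hu1, hG1⟩ := hu.approx
  have hφm : ∀ n, Measurable (φ n) := fun n => (hφ n).contDiff.continuous.measurable
  obtain ⟨ns, hns, hae⟩ := (tendstoInMeasure_of_tendsto_eLpNorm two_ne_zero
    (fun n => (hφm n).aestronglyMeasurable) hu.memLp.1 (by
      simp_rw [eLpNorm_sub_comm _ u]
      exact hu1)).exists_seq_tendsto_ae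
  have hup : ∀ n, choquardEnergy μ Ω (φ n) ≤ C * ((eLpNorm G 2 (volume.restrict Ω) +
      eLpNorm (fun x => G x - ∇ (φ n) x) 2 (volume.restrict Ω)) ^ (2 : ℝ)) ^ p := by
    intro n
    refine (h _ (hφ n)).trans (mul_le_mul_right (ENNReal.rpow_le_rpow ?_ hp.le) _)
    rw [lintegral_enorm_sq_eq]
    refine ENNReal.rpow_le_rpow ?_ (by norm_num)
    have hgm : AEStronglyMeasurable (∇ (φ n)) (volume.restrict Ω) :=
      (continuous_gradient (hφ n).contDiff).aestronglyMeasurable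
    calc _ = eLpNorm (G - (fun x => G x - ∇ (φ n) x)) 2 (volume.restrict Ω) := by
          congr 1; ext1 x; simp
      _ ≤ _ := eLpNorm_sub_le hu.memLp_grad.1 (hu.memLp_grad.1.sub hgm) one_le_two
  have hlim : Tendsto (fun n => C * ((eLpNorm G 2 (volume.restrict Ω) +
      eLpNorm (fun x => G x - ∇ (φ n) x) 2 (volume.restrict Ω)) ^ (2 : ℝ)) ^ p) atTop
      (𝓝 (C * (∫⁻ x in Ω, ‖G x‖ₑ ^ 2) ^ p)) := by
    have hcont : Continuous fun t : ℝ≥0∞ =>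
        C * ((eLpNorm G 2 (volume.restrict Ω) + t) ^ (2 : ℝ)) ^ p :=
      (ENNReal.continuous_const_mul hC).comp (ENNReal.continuous_rpow_const.comp
        (ENNReal.continuous_rpow_const.comp (continuous_const.add continuous_id)))
    have := (hcont.tendsto 0).comp hG1
    rw [add_zero, ← lintegral_enorm_sq_eq] at this
    exact this
  refine (choquardEnergy_le_liminf hq (fun k => hφm (ns k)) hae).trans ?_
  rw [← (hlim.comp hns.tendsto_atTop).liminf_eq]
  exact liminf_le_liminf (Eventually.of_forall fun k => hup (ns k))

/-! ### Balanced half-spaces -/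

theorem choquardEnergy_eq_prod {N : ℕ} (μ : ℝ) (A : Set (Space N)) {u : Space N → ℝ}
    (hu : Measurable u) : choquardEnergy μ A u = ∫⁻ q in A ×ˢ A,
      ENNReal.ofReal (|u q.1| ^ critExp N μ * |u q.2| ^ critExp N μ / ‖q.1 - q.2‖ ^ μ)
      ∂(volume.prod volume) := by
  rw [← Measure.prod_restrict, lintegral_prod]
  · rfl
  · fun_prop

theorem tendsto_choquardEnergy {N : ℕ} {μ : ℝ} {ι : Type*} {l : Filter ι}
    [l.IsCountablyGenerated] {A : ι → Set (Space N)} {B : Set (Space N)}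
    (hA : ∀ i, MeasurableSet (A i)) (hB : MeasurableSet B)
    (hAB : ∀ᵐ x, ∀ᶠ i in l, x ∈ A i ↔ x ∈ B) {u : Space N → ℝ} (hu : Measurable u)
    (hfin : choquardEnergy μ univ u ≠ ⊤) :
    Tendsto (fun i => choquardEnergy μ (A i) u) l (𝓝 (choquardEnergy μ B u)) := by
  set g : Space N × Space N → ℝ≥0∞ := fun q =>
    ENNReal.ofReal (|u q.1| ^ critExp N μ * |u q.2| ^ critExp N μ / ‖q.1 - q.2‖ ^ μ) with hg
  have hgm : Measurable g := by fun_prop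
  simp_rw [choquardEnergy_eq_prod μ _ hu]
  rw [← lintegral_indicator (hB.prod hB)]
  simp_rw [← lintegral_indicator ((hA _).prod (hA _))]
  rw [choquardEnergy_eq_prod μ _ hu, univ_prod_univ, Measure.restrict_univ] at hfin
  refine tendsto_lintegral_filter_of_dominated_convergence g
    (Eventually.of_forall fun i => hgm.indicator ((hA i).prod (hA i)))
    (Eventually.of_forall fun i => Eventually.of_forall fun q => indicator_le_self _ _ _) hfin ?_
  have h1 := Measure.quasiMeasurePreserving_fst (μ := (volume : Measure (Space N)))
    (ν := (volume : Measure (Space N))) |>.ae hAB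
  have h2 := Measure.quasiMeasurePreserving_snd (μ := (volume : Measure (Space N)))
    (ν := (volume : Measure (Space N))) |>.ae hAB
  filter_upwards [h1, h2] with q hq1 hq2
  refine tendsto_const_nhds.congr' ?_
  filter_upwards [hq1, hq2] with i hi1 hi2
  have hq : q ∈ A i ×ˢ A i ↔ q ∈ B ×ˢ B := and_congr hi1 hi2
  by_cases hqB : q ∈ B ×ˢ B
  · rw [indicator_of_mem hqB, indicator_of_mem (hq.mpr hqB)]
  · rw [indicator_of_notMem hqB, indicator_of_notMem (mt hq.mp hqB)]

theorem choquardEnergy_eq_zero {N : ℕ} {μ : ℝ} (hp : 0 < critExp N μ) {A : Set (Space N)}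
    (hA : MeasurableSet A) {u : Space N → ℝ} (hu : ∀ x ∈ A, u x = 0) :
    choquardEnergy μ A u = 0 := by
  unfold choquardEnergy
  rw [setLIntegral_congr_fun hA (g := fun _ => 0), lintegral_zero]
  intro x hx
  simp [hu x hx, Real.zero_rpow hp.ne']

theorem volume_hyperplane {N : ℕ} (o : Space N) {w : Space N} (hw : w ≠ 0) :
    volume {x : Space N | inner ℝ w (x - o) = 0} = 0 := by
  have h : {x : Space N | inner ℝ w (x - o) = 0} =
      (AffineSubspace.mk' o (ℝ ∙ w)ᗮ : AffineSubspace ℝ (Space N)) := by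
    ext x
    rw [SetLike.mem_coe, AffineSubspace.mem_mk', Submodule.mem_orthogonal_singleton_iff_inner_right]
    rfl
  rw [h]
  refine Measure.addHaar_affineSubspace _ _ fun htop => ?_
  have h2 := congrArg AffineSubspace.direction htop
  rw [AffineSubspace.direction_mk', AffineSubspace.direction_top, Submodule.orthogonal_eq_top_iff,
    Submodule.span_singleton_eq_bot] at h2
  exact hw h2

theorem volume_coord_eq {N : ℕ} (i : Fin N) (t : ℝ) : volume {x : Space N | x i = t} = 0 := by
  have h := volume_hyperplane (EuclideanSpace.single i t) (w := EuclideanSpace.single i (1 : ℝ))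
    (by simp)
  refine measure_mono_null (fun x hx => ?_) h
  have hx' : x i = t := hx
  simp [hx', EuclideanSpace.inner_single_left]

theorem measurableSet_lt_coord {N : ℕ} (i : Fin N) (t : ℝ) :
    MeasurableSet {x : Space N | t < x i} :=
  (isOpen_lt (by fun_prop) (by fun_prop)).measurableSet

theorem measurableSet_coord_lt {N : ℕ} (i : Fin N) (t : ℝ) :
    MeasurableSet {x : Space N | x i < t} :=
  (isOpen_lt (by fun_prop) (by fun_prop)).measurableSet

/-- In every coordinate direction there is a hyperplane whose two sides carry the same energy. -/
theorem exists_balanced_hyperplane {N : ℕ} {μ : ℝ} (hp : 0 < critExp N μ) {φ : Space N → ℝ}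
    (hφ : Continuous φ) (hc : HasCompactSupport φ) (hfin : choquardEnergy μ univ φ ≠ ⊤)
    (i : Fin N) : ∃ t : ℝ,
      choquardEnergy μ {x | t < x i} φ = choquardEnergy μ {x | x i < t} φ := by
  have hne : ∀ t : ℝ, ∀ᵐ x : Space N, x i ≠ t := fun t => by
    rw [ae_iff]
    simpa using volume_coord_eq i t
  have ha : Continuous fun t : ℝ => choquardEnergy μ {x | t < x i} φ := by
    refine continuous_iff_continuousAt.mpr fun t => ?_
    refine tendsto_choquardEnergy (fun s => measurableSet_lt_coord i s)
      (measurableSet_lt_coord i t) ?_ hφ.measurable hfin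
    filter_upwards [hne t] with x hx
    rcases lt_or_gt_of_ne hx with h | h
    · filter_upwards [lt_mem_nhds h] with s hs
      exact ⟨fun h' => absurd h' (not_lt.mpr hs.le), fun h' => absurd h' (not_lt.mpr h.le)⟩
    · filter_upwards [gt_mem_nhds h] with s hs
      exact ⟨fun _ => h, fun _ => hs⟩
  have hb : Continuous fun t : ℝ => choquardEnergy μ {x | x i < t} φ := by
    refine continuous_iff_continuousAt.mpr fun t => ?_
    refine tendsto_choquardEnergy (fun s => measurableSet_coord_lt i s)
      (measurableSet_coord_lt i t) ?_ hφ.measurable hfin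
    filter_upwards [hne t] with x hx
    rcases lt_or_gt_of_ne hx with h | h
    · filter_upwards [lt_mem_nhds h] with s hs
      exact ⟨fun _ => h, fun _ => hs⟩
    · filter_upwards [gt_mem_nhds h] with s hs
      exact ⟨fun h' => absurd h' (not_lt.mpr hs.le), fun h' => absurd h' (not_lt.mpr h.le)⟩
  obtain ⟨M, hM⟩ := hc.isCompact.isBounded.subset_closedBall (0 : Space N)
  have hzero : ∀ x : Space N, M < |x i| → φ x = 0 := fun x hx => by
    refine image_eq_zero_of_notMem_tsupport fun h => ?_
    have h1 := hM h
    rw [mem_closedBall_zero_iff] at h1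
    have h2 := PiLp.norm_apply_le x i
    rw [Real.norm_eq_abs] at h2
    linarith
  refine intermediate_value_univ₂ (a := M) (b := -M) ha hb ?_ ?_
  · rw [choquardEnergy_eq_zero hp (measurableSet_lt_coord i M) fun x hx =>
      hzero x (lt_of_lt_of_le hx (le_abs_self _))]
    exact zero_le
  · rw [choquardEnergy_eq_zero hp (measurableSet_coord_lt i (-M)) fun x hx =>
      hzero x (lt_abs.mpr (Or.inr (lt_neg.mpr hx)))]
    exact zero_le

theorem rieszEnergy_comm {N : ℕ} {μ : ℝ} (ν₁ ν₂ : Measure (Space N)) [SFinite ν₁] [SFinite ν₂] :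
    rieszEnergy μ ν₁ ν₂ = rieszEnergy μ ν₂ ν₁ := by
  unfold rieszEnergy
  rw [lintegral_lintegral_swap (by fun_prop)]
  simp_rw [norm_sub_rev]

theorem rieszEnergy_add {N : ℕ} {μ : ℝ} (ν₁ ν₂ : Measure (Space N)) [SFinite ν₁] [SFinite ν₂] :
    rieszEnergy μ (ν₁ + ν₂) (ν₁ + ν₂) =
      rieszEnergy μ ν₁ ν₁ + rieszEnergy μ ν₂ ν₂ + 2 * rieszEnergy μ ν₁ ν₂ := by
  have h : ∀ ν ν' : Measure (Space N), ∀ [SFinite ν], Measurable fun x : Space N =>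
      ∫⁻ y, ENNReal.ofReal (‖x - y‖ ^ (-μ)) ∂ν := fun ν _ _ =>
    Measurable.lintegral_prod_right' (f := fun q : Space N × Space N =>
      ENNReal.ofReal (‖q.1 - q.2‖ ^ (-μ))) (by fun_prop)
  have h1 : rieszEnergy μ (ν₁ + ν₂) (ν₁ + ν₂) = rieszEnergy μ ν₁ ν₁ + rieszEnergy μ ν₁ ν₂ +
      (rieszEnergy μ ν₂ ν₁ + rieszEnergy μ ν₂ ν₂) := by
    unfold rieszEnergy
    simp_rw [lintegral_add_measure]
    rw [lintegral_add_left (h ν₁ ν₁), lintegral_add_left (h ν₁ ν₁)]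
  rw [h1, rieszEnergy_comm ν₂ ν₁]
  ring

/-- A smooth function can be cut by a hyperplane so that one half has at most half the Dirichlet
energy but more than a quarter of the Choquard energy, by a factor independent of the function. -/
theorem exists_halfSpace_gap {N : ℕ} (hN : 4 ≤ N) {μ : ℝ} (hμ0 : 0 < μ) (hμN : μ < N) :
    ∃ θ : ℝ, 1 < θ ∧ ∀ φ : Space N → ℝ, Continuous φ → HasCompactSupport φ →
      choquardEnergy μ univ φ ≠ ⊤ → ∀ g : Space N → ℝ≥0∞, ∃ o w : Space N, ‖w‖ = 1 ∧
      ENNReal.ofReal θ * choquardEnergy μ univ φ ≤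
        4 * choquardEnergy μ {x | 0 < inner ℝ w (x - o)} φ ∧
      2 * ∫⁻ x in {x | 0 < inner ℝ w (x - o)}, g x ≤ ∫⁻ x, g x := by
  obtain ⟨δ, hδ0, hδt, h⟩ := exists_half_energy_gap (by omega : 0 < N) hμ0
  have hp := critExp_pos hN hμN
  refine ⟨1 + δ.toReal, by linarith [ENNReal.toReal_pos hδ0 hδt], fun φ hφ hc hfin g => ?_⟩
  choose t ht using exists_balanced_hyperplane hp hφ hc hfin
  set o : Space N := WithLp.toLp 2 t with ho
  have hoi : ∀ i, o i = t i := fun i => rfl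
  set ν := choquardMeasure μ φ with hν
  have hac : ν ≪ volume := by rw [hν]; exact withDensity_absolutelyContinuous _ _
  have : Nonempty (Fin N) := ⟨⟨0, by omega⟩⟩
  have : NullSingletonClass ν := ⟨fun x => hac (measure_singleton x)⟩
  have hr : ∀ A : Set (Space N), MeasurableSet A →
      rieszEnergy μ (ν.restrict A) (ν.restrict A) = choquardEnergy μ A φ := fun A hA => by
    rw [choquardEnergy_eq, hν, rieszEnergy_choquardMeasure μ hA hA hφ]
  have hru : rieszEnergy μ ν ν = choquardEnergy μ univ φ := by
    rw [← hr univ MeasurableSet.univ, Measure.restrict_univ]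
  have : SFinite ν := by rw [hν, choquardMeasure]; infer_instance
  obtain ⟨i, hi⟩ := h ν (by rw [hru]; exact hfin) o
  rw [hoi] at hi
  set P : Set (Space N) := {x | t i < x i} with hP
  set M : Set (Space N) := {x | x i < t i} with hM
  have hPm : MeasurableSet P := measurableSet_lt_coord i (t i)
  have hMm : MeasurableSet M := measurableSet_coord_lt i (t i)
  have hd : Disjoint P M := disjoint_left.mpr fun x (h1 : t i < x i) (h2 : x i < t i) => lt_asymm h1 h2
  have hsum : ν.restrict P + ν.restrict M = ν := by
    rw [← Measure.restrict_union hd hMm]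
    refine Measure.restrict_eq_self_of_ae_mem ?_
    have h0 : ∀ᵐ x : Space N, x i ≠ t i := by
      rw [ae_iff]; simpa using volume_coord_eq i (t i)
    filter_upwards [hac.ae_le h0] with x hx
    rcases lt_or_gt_of_ne hx with h | h
    · exact Or.inr h
    · exact Or.inl h
  have hD := rieszEnergy_add (μ := μ) (ν.restrict P) (ν.restrict M)
  rw [hsum, hru] at hD
  rw [hr P hPm, hr M hMm, hru, ← ht i] at hi
  rw [hr P hPm, hr M hMm, ← ht i] at hD
  have hmain : ENNReal.ofReal (1 + δ.toReal) * choquardEnergy μ univ φ ≤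
      4 * choquardEnergy μ P φ := by
    rw [ENNReal.ofReal_add zero_le_one ENNReal.toReal_nonneg, ENNReal.ofReal_one,
      ENNReal.ofReal_toReal hδt, add_mul, one_mul]
    nth_rw 1 [hD]
    rw [add_assoc]
    refine (add_le_add_right hi _).trans (le_of_eq ?_)
    ring
  have hPw : {x : Space N | 0 < inner ℝ (EuclideanSpace.single i (1 : ℝ)) (x - o)} = P := by
    ext x
    simp [hP, EuclideanSpace.inner_single_left, hoi]
  have hMw : {x : Space N | 0 < inner ℝ (-EuclideanSpace.single i (1 : ℝ)) (x - o)} = M := by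
    ext x
    simp [hM, EuclideanSpace.inner_single_left, hoi]
  rcases le_or_gt (2 * ∫⁻ x in P, g x) (∫⁻ x, g x) with hg | hg
  · refine ⟨o, EuclideanSpace.single i 1, by simp, ?_, ?_⟩
    · rw [hPw]; exact hmain
    · rw [hPw]; exact hg
  · refine ⟨o, -EuclideanSpace.single i 1, by simp, ?_, ?_⟩
    · rw [hMw, ← ht i]; exact hmain
    · rw [hMw]
      by_contra! hg'
      have h1 := ENNReal.add_lt_add hg hg'
      rw [← two_mul, ← mul_add, ← lintegral_union hMm hd] at h1
      exact absurd h1 (not_lt.mpr (mul_le_mul_right (setLIntegral_le_lintegral _ _) _))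

/-! ### Concentration at a boundary point -/

/-- The similarity `x ↦ o + ε⁻¹ L (x - x₀)`, which blows up a neighbourhood of `x₀`. -/
noncomputable def blowUp {N : ℕ} (x₀ o : Space N) (L : Space N ≃ₗᵢ[ℝ] Space N) (ε : ℝ)
    (hε : ε ≠ 0) : Space N ≃ₜ Space N :=
  (((Homeomorph.subRight x₀).trans L.toHomeomorph).trans
    (Homeomorph.smulOfNeZero ε⁻¹ (inv_ne_zero hε))).trans (Homeomorph.addLeft o)

theorem blowUp_apply {N : ℕ} (x₀ o : Space N) (L : Space N ≃ₗᵢ[ℝ] Space N) {ε : ℝ}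
    (hε : ε ≠ 0) (x : Space N) : blowUp x₀ o L ε hε x = o + ε⁻¹ • L (x - x₀) := rfl

theorem blowUp_symm_apply {N : ℕ} (x₀ o : Space N) (L : Space N ≃ₗᵢ[ℝ] Space N) {ε : ℝ}
    (hε : ε ≠ 0) (y : Space N) :
    (blowUp x₀ o L ε hε).symm y = x₀ + ε • L.symm (y - o) := by
  rw [Homeomorph.symm_apply_eq, blowUp_apply]
  simp [smul_smul, inv_mul_cancel₀ hε]

theorem norm_sub_eq_mul_blowUp {N : ℕ} (x₀ o : Space N) (L : Space N ≃ₗᵢ[ℝ] Space N) {ε : ℝ}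
    (hε : 0 < ε) (x y : Space N) :
    ‖x - y‖ = ε * ‖blowUp x₀ o L ε hε.ne' x - blowUp x₀ o L ε hε.ne' y‖ := by
  rw [blowUp_apply, blowUp_apply, add_sub_add_left_eq_sub, ← smul_sub, ← map_sub, norm_smul,
    LinearIsometryEquiv.norm_map, sub_sub_sub_cancel_right, Real.norm_of_nonneg (by positivity),
    mul_inv_cancel_left₀ hε.ne']

theorem lintegral_comp_blowUp {N : ℕ} (x₀ o : Space N) (L : Space N ≃ₗᵢ[ℝ] Space N) {ε : ℝ}
    (hε : 0 < ε) {Ω : Set (Space N)} (hΩ : MeasurableSet Ω) (F : Space N → ℝ≥0∞) :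
    ∫⁻ x in Ω, F (blowUp x₀ o L ε hε.ne' x) =
      ENNReal.ofReal (ε ^ (N : ℝ)) * ∫⁻ y in (blowUp x₀ o L ε hε.ne').symm ⁻¹' Ω, F y := by
  set Φ := blowUp x₀ o L ε hε.ne' with hΦ
  have hΩ' : MeasurableSet (Φ.symm ⁻¹' Ω) := Φ.symm.continuous.measurable hΩ
  rw [← lintegral_indicator hΩ, ← lintegral_indicator hΩ']
  set f := (Φ.symm ⁻¹' Ω).indicator F with hf
  have h1 : ∀ x, Ω.indicator (fun x => F (Φ x)) x = f (o + ε⁻¹ • L (x - x₀)) := by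
    intro x
    rw [← blowUp_apply x₀ o L hε.ne', ← hΦ, hf]
    have hmem : Φ x ∈ Φ.symm ⁻¹' Ω ↔ x ∈ Ω := by rw [mem_preimage, Φ.symm_apply_apply]
    by_cases hx : x ∈ Ω
    · rw [indicator_of_mem hx, indicator_of_mem (hmem.mpr hx)]
    · rw [indicator_of_notMem hx, indicator_of_notMem (mt hmem.mp hx)]
  simp_rw [h1]
  rw [lintegral_sub_right_eq_self (fun x => f (o + ε⁻¹ • L x)) x₀]
  have h2 := L.measurePreserving.lintegral_comp_emb L.toHomeomorph.measurableEmbedding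
    (fun x => f (o + ε⁻¹ • x))
  have h3 := lintegral_comp_smul_eq (volume : Measure (Space N)) (fun x => f (o + x))
    (inv_pos.mpr hε)
  rw [h2, h3, lintegral_add_left_eq_self f o, finrank_euclideanSpace, Fintype.card_fin,
    Real.inv_rpow hε.le, Real.rpow_neg hε.le, inv_inv]

theorem contDiff_comp_blowUp {N : ℕ} (x₀ o : Space N) (L : Space N ≃ₗᵢ[ℝ] Space N) {ε : ℝ}
    (hε : ε ≠ 0) {φ : Space N → ℝ} (hφ : ContDiff ℝ ∞ φ) :
    ContDiff ℝ ∞ fun x => φ (blowUp x₀ o L ε hε x) := by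
  simp_rw [blowUp_apply]
  refine hφ.comp (contDiff_const.add (ContDiff.const_smul _ (L.contDiff.comp ?_)))
  fun_prop

theorem enorm_gradient_comp_blowUp {N : ℕ} (x₀ o : Space N) (L : Space N ≃ₗᵢ[ℝ] Space N) {ε : ℝ}
    (hε : 0 < ε) {φ : Space N → ℝ} (hφ : ContDiff ℝ ∞ φ) (x : Space N) :
    ‖∇ (fun x => φ (blowUp x₀ o L ε hε.ne' x)) x‖ₑ =
      ENNReal.ofReal ε⁻¹ * ‖∇ φ (blowUp x₀ o L ε hε.ne' x)‖ₑ := by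
  have h1 : HasFDerivAt (fun x => blowUp x₀ o L ε hε.ne' x)
      (ε⁻¹ • (L : Space N →L[ℝ] Space N)) x := by
    simp_rw [blowUp_apply]
    exact ((((L : Space N →L[ℝ] Space N).hasFDerivAt (x := x - x₀)).comp x
      ((hasFDerivAt_id x).sub_const x₀)).const_smul ε⁻¹).const_add o
  have h2 := ((hφ.differentiable (by simp)) (blowUp x₀ o L ε hε.ne' x)).hasFDerivAt.comp x h1
  rw [enorm_gradient, enorm_gradient]
  change ‖fderiv ℝ (φ ∘ fun x => blowUp x₀ o L ε hε.ne' x) x‖ₑ = _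
  rw [h2.fderiv, ContinuousLinearMap.comp_smul, enorm_smul, Real.enorm_of_nonneg (by positivity),
    ← ofReal_norm, ← ofReal_norm]
  congr 2
  exact ContinuousLinearMap.opNorm_comp_linearIsometryEquiv _ L

theorem dirichlet_comp_blowUp {N : ℕ} (x₀ o : Space N) (L : Space N ≃ₗᵢ[ℝ] Space N) {ε : ℝ}
    (hε : 0 < ε) {Ω : Set (Space N)} (hΩ : MeasurableSet Ω) {φ : Space N → ℝ}
    (hφ : ContDiff ℝ ∞ φ) :
    ∫⁻ x in Ω, ‖∇ (fun x => φ (blowUp x₀ o L ε hε.ne' x)) x‖ₑ ^ 2 =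
      ENNReal.ofReal (ε ^ (N - 2 : ℝ)) *
        ∫⁻ y in (blowUp x₀ o L ε hε.ne').symm ⁻¹' Ω, ‖∇ φ y‖ₑ ^ 2 := by
  simp_rw [enorm_gradient_comp_blowUp x₀ o L hε hφ, mul_pow]
  rw [lintegral_const_mul' _ _ (ENNReal.pow_ne_top ENNReal.ofReal_ne_top),
    lintegral_comp_blowUp x₀ o L hε hΩ (fun y => ‖∇ φ y‖ₑ ^ 2), ← mul_assoc,
    ← ENNReal.ofReal_pow (by positivity), ← ENNReal.ofReal_mul (by positivity)]
  congr 2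
  rw [Real.rpow_sub hε, Real.rpow_two]
  field_simp

theorem choquardEnergy_comp_blowUp {N : ℕ} (x₀ o : Space N) (L : Space N ≃ₗᵢ[ℝ] Space N) {ε : ℝ}
    (hε : 0 < ε) {Ω : Set (Space N)} (hΩ : MeasurableSet Ω) (μ : ℝ) (φ : Space N → ℝ) :
    choquardEnergy μ Ω (fun x => φ (blowUp x₀ o L ε hε.ne' x)) =
      ENNReal.ofReal (ε ^ (2 * N - μ : ℝ)) *
        choquardEnergy μ ((blowUp x₀ o L ε hε.ne').symm ⁻¹' Ω) φ := by
  set Φ := blowUp x₀ o L ε hε.ne' with hΦ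
  rw [choquardEnergy_eq, choquardEnergy_eq]
  have h1 : ∀ x y, ENNReal.ofReal (|φ (Φ x)| ^ critExp N μ) *
      ENNReal.ofReal (|φ (Φ y)| ^ critExp N μ) * ENNReal.ofReal (‖x - y‖ ^ (-μ)) =
      ENNReal.ofReal (ε ^ (-μ)) * (ENNReal.ofReal (|φ (Φ x)| ^ critExp N μ) *
      ENNReal.ofReal (|φ (Φ y)| ^ critExp N μ) * ENNReal.ofReal (‖Φ x - Φ y‖ ^ (-μ))) :=
    fun x y => by
      rw [norm_sub_eq_mul_blowUp x₀ o L hε x y, Real.mul_rpow hε.le (norm_nonneg _),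
        ENNReal.ofReal_mul (by positivity), mul_left_comm]
  simp_rw [h1]
  simp_rw [lintegral_const_mul' _ _ (ENNReal.ofReal_ne_top (r := ε ^ (-μ)))]
  have h2 : ∀ x, ∫⁻ y in Ω, ENNReal.ofReal (|φ (Φ x)| ^ critExp N μ) *
      ENNReal.ofReal (|φ (Φ y)| ^ critExp N μ) * ENNReal.ofReal (‖Φ x - Φ y‖ ^ (-μ)) =
      ENNReal.ofReal (ε ^ (N : ℝ)) * ∫⁻ y in Φ.symm ⁻¹' Ω,
        ENNReal.ofReal (|φ (Φ x)| ^ critExp N μ) *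
        ENNReal.ofReal (|φ y| ^ critExp N μ) * ENNReal.ofReal (‖Φ x - y‖ ^ (-μ)) := fun x =>
    lintegral_comp_blowUp x₀ o L hε hΩ fun y => ENNReal.ofReal (|φ (Φ x)| ^ critExp N μ) *
      ENNReal.ofReal (|φ y| ^ critExp N μ) * ENNReal.ofReal (‖Φ x - y‖ ^ (-μ))
  simp_rw [h2]
  rw [lintegral_const_mul' _ _ ENNReal.ofReal_ne_top,
    lintegral_comp_blowUp x₀ o L hε hΩ fun x => ∫⁻ y in Φ.symm ⁻¹' Ω,
        ENNReal.ofReal (|φ x| ^ critExp N μ) *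
        ENNReal.ofReal (|φ y| ^ critExp N μ) * ENNReal.ofReal (‖x - y‖ ^ (-μ)),
    ← mul_assoc, ← mul_assoc, ← ENNReal.ofReal_mul (by positivity),
    ← ENNReal.ofReal_mul (by positivity), ← Real.rpow_add hε, ← Real.rpow_add hε]
  congr 3; ring

/-- In the blow-up limit, the domain becomes a half-space. -/
theorem IsBoundaryGraph.eventually_mem_iff {N : ℕ} {Ω : Set (Space N)} {x₀ : Space N}
    {T : Space N ≃ₗᵢ[ℝ] SplitSpace N} {ρ : EuclideanSpace ℝ (Fin (N - 1)) → ℝ} {R : ℝ}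
    (h : IsBoundaryGraph Ω x₀ T ρ R) {v : Space N} (hv : (T v).snd ≠ 0) :
    ∀ᶠ ε in 𝓝[>] (0 : ℝ), x₀ + ε • v ∈ Ω ↔ 0 < (T v).snd := by
  have hdiff : HasFDerivAt ρ (0 : EuclideanSpace ℝ (Fin (N - 1)) →L[ℝ] ℝ) 0 := by
    rw [← h.fderiv_zero]
    exact ((h.smooth.contDiffAt (ball_mem_nhds 0 h.pos)).differentiableAt (by simp)).hasFDerivAt
  have hline : HasDerivAt (fun t : ℝ => ρ (t • (T v).fst)) 0 0 := by
    have h1 : HasDerivAt (fun t : ℝ => t • (T v).fst) (T v).fst 0 := by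
      simpa using (hasDerivAt_id (0 : ℝ)).smul_const (T v).fst
    have h2 : HasFDerivAt ρ (0 : EuclideanSpace ℝ (Fin (N - 1)) →L[ℝ] ℝ)
        ((0 : ℝ) • (T v).fst) := by rwa [zero_smul]
    have h3 := h2.comp_hasDerivAt (0 : ℝ) h1
    rw [_root_.zero_apply] at h3
    exact h3
  have hslope : Tendsto (fun t : ℝ => t⁻¹ * ρ (t • (T v).fst)) (𝓝[>] 0) (𝓝 0) := by
    have := hline.tendsto_slope_zero_right
    simpa [h.map_zero] using this
  have hball : ∀ᶠ ε in 𝓝[>] (0 : ℝ), x₀ + ε • v ∈ ball x₀ R := by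
    have hcont : Continuous fun ε : ℝ => x₀ + ε • v := by fun_prop
    refine (hcont.tendsto' 0 x₀ (by simp)).mono_left nhdsWithin_le_nhds (ball_mem_nhds x₀ h.pos)
  have hsmall := hslope.eventually (Metric.ball_mem_nhds (0 : ℝ) (abs_pos.mpr hv))
  filter_upwards [hball, hsmall, self_mem_nhdsWithin] with ε h1 h2 h3
  rw [mem_Ioi] at h3
  rw [h.mem_iff _ h1, add_sub_cancel_left, map_smul]
  change ρ (ε • (T v).fst) < ε * (T v).snd ↔ _
  rw [dist_zero_right, Real.norm_eq_abs] at h2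
  have h4 : ρ (ε • (T v).fst) = ε * (ε⁻¹ * ρ (ε • (T v).fst)) := by field_simp
  rw [h4, mul_lt_mul_iff_right₀ h3]
  have h5 := abs_lt.mp h2
  rcases lt_or_gt_of_ne hv with hs | hs
  · rw [abs_of_neg hs, neg_neg] at h5
    exact ⟨fun h => absurd h (not_lt.mpr h5.1.le), fun h => absurd h (not_lt.mpr hs.le)⟩
  · rw [abs_of_pos hs] at h5
    exact ⟨fun _ => hs, fun _ => h5.2⟩

theorem exists_linearIsometryEquiv_map_eq {N : ℕ} {e w : Space N} (h : ‖e‖ = ‖w‖) :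
    ∃ L : Space N ≃ₗᵢ[ℝ] Space N, L e = w :=
  ⟨_, Submodule.reflection_sub h⟩

theorem integral_norm_sq_eq {α E : Type*} [MeasurableSpace α] [NormedAddCommGroup E]
    {m : Measure α} {f : α → E} (hf : AEStronglyMeasurable f m) :
    ∫ x, ‖f x‖ ^ 2 ∂m = (∫⁻ x, ‖f x‖ₑ ^ 2 ∂m).toReal := by
  rw [integral_eq_lintegral_of_nonneg_ae (Eventually.of_forall fun x => by positivity)
    (by exact hf.norm.pow 2)]
  congr 1
  refine lintegral_congr fun x => ?_
  rw [ENNReal.ofReal_pow (norm_nonneg _), ofReal_norm]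

/-- The quotient of a concentrating family of rescaled test functions is, up to a term of order
`ε ^ 2`, the quotient of the Dirichlet and Choquard energies over the blown-up domain. -/
theorem neumannConstant_le_blowUp {N : ℕ} (hN : 4 ≤ N) {μ : ℝ} (hμN : μ < N)
    {Ω : Set (Space N)} (hΩ : MeasurableSet Ω) {a : Space N → ℝ} {M : ℝ}
    (hM : ∀ x ∈ Ω, |a x| ≤ M) {φ : Space N → ℝ} (hφ : ContDiff ℝ ∞ φ) (hc : HasCompactSupport φ)
    (hfin : choquardEnergy μ univ φ ≠ ⊤) (x₀ o : Space N) (L : Space N ≃ₗᵢ[ℝ] Space N) {ε : ℝ}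
    (hε : 0 < ε) (hpos : 0 < choquardEnergy μ ((blowUp x₀ o L ε hε.ne').symm ⁻¹' Ω) φ) :
    neumannConstant μ Ω a ≤
      ((((∫⁻ y in (blowUp x₀ o L ε hε.ne').symm ⁻¹' Ω, ‖∇ φ y‖ₑ ^ 2).toReal +
        M * ε ^ 2 * (∫⁻ y, ‖φ y‖ₑ ^ 2).toReal) /
        (choquardEnergy μ ((blowUp x₀ o L ε hε.ne').symm ⁻¹' Ω) φ).toReal ^ (1 / critExp N μ) :
          ℝ) : EReal) := by
  have hN4 : (4 : ℝ) ≤ N := by exact_mod_cast hN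
  have hp := critExp_pos hN hμN
  have hD := choquardEnergy_comp_blowUp x₀ o L hε hΩ μ φ
  have hE := dirichlet_comp_blowUp x₀ o L hε hΩ hφ
  have hB := lintegral_comp_blowUp x₀ o L hε hΩ fun y => ‖φ y‖ₑ ^ 2
  have hu : ContDiff ℝ ∞ fun x => φ (blowUp x₀ o L ε hε.ne' x) :=
    contDiff_comp_blowUp x₀ o L hε.ne' hφ
  have huc : HasCompactSupport fun x => φ (blowUp x₀ o L ε hε.ne' x) :=
    hc.comp_homeomorph (blowUp x₀ o L ε hε.ne')
  set Φ := blowUp x₀ o L ε hε.ne' with hΦ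
  set A := Φ.symm ⁻¹' Ω with hA
  set u : Space N → ℝ := fun x => φ (Φ x) with hu_def
  have hH1 := isH1_of_contDiff Ω hu huc
  have hDne : choquardEnergy μ Ω u ≠ 0 := by
    rw [hD]
    refine mul_ne_zero ?_ hpos.ne'
    rw [Ne, ENNReal.ofReal_eq_zero, not_le]
    positivity
  have hu0 : ¬ ∀ᵐ x ∂volume.restrict Ω, u x = 0 := by
    intro h0
    refine hDne ?_
    unfold choquardEnergy
    rw [← lintegral_zero (μ := volume.restrict Ω)]
    refine lintegral_congr_ae ?_
    filter_upwards [h0] with x hx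
    simp [hx, Real.zero_rpow hp.ne']
  have hmem : neumannConstant μ Ω a ≤ (sobolevQuotient μ Ω a u (∇ u) : EReal) :=
    sInf_le ⟨u, ∇ u, hH1, hu0, rfl⟩
  refine hmem.trans (EReal.coe_le_coe_iff.mpr ?_)
  have hAt : choquardEnergy μ A φ ≠ ⊤ :=
    ((choquardEnergy_mono μ (subset_univ A) φ).trans_lt hfin.lt_top).ne
  set d := (choquardEnergy μ A φ).toReal with hd
  have hd0 : 0 < d := ENNReal.toReal_pos hpos.ne' hAt
  have hnorm : choquardNormSq μ Ω u = ε ^ (N - 2 : ℝ) * d ^ (1 / critExp N μ) := by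
    rw [choquardNormSq, hD, ENNReal.toReal_mul, ENNReal.toReal_ofReal (by positivity),
      Real.mul_rpow (by positivity) hd0.le, ← Real.rpow_mul hε.le]
    congr 2
    have h1 : (N : ℝ) - 2 ≠ 0 := by linarith
    have h2 : 2 * (N : ℝ) - μ ≠ 0 := by linarith
    rw [critExp]; field_simp
  have hEr : ∫ x in Ω, ‖∇ u x‖ ^ 2 = ε ^ (N - 2 : ℝ) * (∫⁻ y in A, ‖∇ φ y‖ₑ ^ 2).toReal := by
    rw [integral_norm_sq_eq hH1.memLp_grad.1, hE, ENNReal.toReal_mul,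
      ENNReal.toReal_ofReal (by positivity)]
  have hL2 : ∫⁻ y, ‖φ y‖ₑ ^ 2 ≠ ⊤ := by
    rw [lintegral_enorm_sq_eq]
    exact ENNReal.rpow_ne_top_of_nonneg (by norm_num)
      (hφ.continuous.memLp_of_hasCompactSupport hc).2.ne
  have hM0 : 0 ≤ M := by
    rcases eq_empty_or_nonempty Ω with h | ⟨x, hx⟩
    · exact absurd (by rw [h, Measure.restrict_empty, ae_zero]; exact eventually_bot) hu0
    · exact (abs_nonneg _).trans (hM x hx)
  have hlow : -(M * (ε ^ (N : ℝ) * (∫⁻ y, ‖φ y‖ₑ ^ 2).toReal)) ≤ ∫ x in Ω, a x * u x ^ 2 := by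
    have hint : Integrable (fun x => M * ‖u x‖ ^ 2) (volume.restrict Ω) :=
      (hH1.memLp.integrable_norm_pow two_ne_zero).const_mul M
    have h1 : ‖∫ x in Ω, a x * u x ^ 2‖ ≤ ∫ x in Ω, M * ‖u x‖ ^ 2 := by
      refine norm_integral_le_of_norm_le hint ?_
      filter_upwards [ae_restrict_mem hΩ] with x hx
      rw [norm_mul, norm_pow, Real.norm_eq_abs]
      exact mul_le_mul_of_nonneg_right (hM x hx) (by positivity)
    rw [integral_const_mul, integral_norm_sq_eq hH1.memLp.1, hB, ENNReal.toReal_mul,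
      ENNReal.toReal_ofReal (by positivity)] at h1
    have h2 : (∫⁻ y in A, ‖φ y‖ₑ ^ 2).toReal ≤ (∫⁻ y, ‖φ y‖ₑ ^ 2).toReal :=
      ENNReal.toReal_mono hL2 (setLIntegral_le_lintegral _ _)
    have h3 := (abs_le.mp (by rwa [Real.norm_eq_abs] at h1)).1
    have h4 : M * (ε ^ (N : ℝ) * (∫⁻ y in A, ‖φ y‖ₑ ^ 2).toReal) ≤
        M * (ε ^ (N : ℝ) * (∫⁻ y, ‖φ y‖ₑ ^ 2).toReal) := by gcongr
    linarith
  rw [sobolevQuotient, hnorm, hEr, div_le_div_iff₀ (by positivity) (by positivity)]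
  have hεN : ε ^ (N : ℝ) = ε ^ (N - 2 : ℝ) * ε ^ 2 := by
    rw [← Real.rpow_natCast ε 2, ← Real.rpow_add hε]; congr 1; push_cast; ring
  rw [hεN] at hlow
  have hdp : 0 ≤ d ^ (1 / critExp N μ) := by positivity
  nlinarith [mul_le_mul_of_nonneg_right hlow hdp]

/-- Concentration at a boundary point: the Neumann constant is at most the quotient of the
Dirichlet and Choquard energies of any test function over any half-space. -/
theorem neumannConstant_le_halfSpace {N : ℕ} (hN : 4 ≤ N) {μ : ℝ} (hμN : μ < N)
    {Ω : Set (Space N)} (hΩ : IsOpen Ω) {a : Space N → ℝ} {M : ℝ}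
    (hM : ∀ x ∈ Ω, |a x| ≤ M) {x₀ : Space N} {T : Space N ≃ₗᵢ[ℝ] SplitSpace N}
    {ρ : EuclideanSpace ℝ (Fin (N - 1)) → ℝ} {R : ℝ} (hgraph : IsBoundaryGraph Ω x₀ T ρ R)
    {φ : Space N → ℝ} (hφ : ContDiff ℝ ∞ φ) (hc : HasCompactSupport φ)
    (hfin : choquardEnergy μ univ φ ≠ ⊤) (o : Space N) {w : Space N} (hw : ‖w‖ = 1)
    (hpos : 0 < choquardEnergy μ {x | 0 < inner ℝ w (x - o)} φ) :
    neumannConstant μ Ω a ≤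
      (((∫⁻ y in {x | 0 < inner ℝ w (x - o)}, ‖∇ φ y‖ₑ ^ 2).toReal /
        (choquardEnergy μ {x | 0 < inner ℝ w (x - o)} φ).toReal ^ (1 / critExp N μ) : ℝ) :
          EReal) := by
  have hp := critExp_pos hN hμN
  -- `e` is the inner normal of `Ω` at `x₀`.
  set e : Space N := T.symm (WithLp.toLp 2 (0, 1)) with he
  have hen : ‖e‖ = 1 := by
    rw [he, LinearIsometryEquiv.norm_map, WithLp.prod_norm_eq_of_L2]
    simp
  have hinner : ∀ v, inner ℝ e v = (T v).snd := by
    intro v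
    rw [← T.inner_map_map, he, T.apply_symm_apply, WithLp.prod_inner_apply]
    simp
  obtain ⟨L, hL⟩ := exists_linearIsometryEquiv_map_eq (hen.trans hw.symm)
  set H : Set (Space N) := {x | 0 < inner ℝ w (x - o)} with hH
  have hHm : MeasurableSet H := (isOpen_lt (by fun_prop) (by fun_prop)).measurableSet
  set A : ℝ → Set (Space N) := fun ε => {y | x₀ + ε • L.symm (y - o) ∈ Ω} with hA
  have hAm : ∀ ε, MeasurableSet (A ε) := fun ε =>
    (hΩ.preimage (f := fun y => x₀ + ε • L.symm (y - o)) (by fun_prop)).measurableSet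
  have hAH : ∀ᵐ y, ∀ᶠ ε in 𝓝[>] (0 : ℝ), y ∈ A ε ↔ y ∈ H := by
    have h0 : ∀ᵐ y : Space N, inner ℝ w (y - o) ≠ 0 := by
      rw [ae_iff]
      simpa using volume_hyperplane o (w := w) (norm_ne_zero_iff.mp (by rw [hw]; simp))
    filter_upwards [h0] with y hy
    have h1 : inner ℝ w (y - o) = (T (L.symm (y - o))).snd := by
      rw [← hinner, ← hL, ← L.inner_map_map e, L.apply_symm_apply]
    rw [h1] at hy
    have h2 : y ∈ H ↔ 0 < (T (L.symm (y - o))).snd := by rw [← h1]; rfl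
    rw [h2]
    exact hgraph.eventually_mem_iff hy
  have hD : Tendsto (fun ε => choquardEnergy μ (A ε) φ) (𝓝[>] 0) (𝓝 (choquardEnergy μ H φ)) :=
    tendsto_choquardEnergy hAm hHm hAH hφ.continuous.measurable hfin
  have hEfin : ∫⁻ y, ‖∇ φ y‖ₑ ^ 2 ≠ ⊤ := by
    rw [lintegral_enorm_sq_eq]
    exact ENNReal.rpow_ne_top_of_nonneg (by norm_num)
      ((continuous_gradient hφ).memLp_of_hasCompactSupport (hasCompactSupport_gradient hc)).2.ne
  have hE : Tendsto (fun ε => ∫⁻ y in A ε, ‖∇ φ y‖ₑ ^ 2) (𝓝[>] 0)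
      (𝓝 (∫⁻ y in H, ‖∇ φ y‖ₑ ^ 2)) := by
    have hgm : Measurable fun y => ‖∇ φ y‖ₑ ^ 2 :=
      (continuous_gradient hφ).measurable.enorm.pow_const 2
    rw [← lintegral_indicator hHm]
    simp_rw [← lintegral_indicator (hAm _)]
    refine tendsto_lintegral_filter_of_dominated_convergence (fun y => ‖∇ φ y‖ₑ ^ 2)
      (Eventually.of_forall fun i => hgm.indicator (hAm i))
      (Eventually.of_forall fun i => Eventually.of_forall fun q => indicator_le_self _ _ _)
      hEfin ?_
    filter_upwards [hAH] with y hy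
    refine tendsto_const_nhds.congr' ?_
    filter_upwards [hy] with ε hε
    by_cases hyH : y ∈ H
    · rw [indicator_of_mem hyH, indicator_of_mem (hε.mpr hyH)]
    · rw [indicator_of_notMem hyH, indicator_of_notMem (mt hε.mp hyH)]
  have hHt : choquardEnergy μ H φ ≠ ⊤ :=
    ((choquardEnergy_mono μ (subset_univ H) φ).trans_lt hfin.lt_top).ne
  have hEt : ∫⁻ y in H, ‖∇ φ y‖ₑ ^ 2 ≠ ⊤ :=
    ((setLIntegral_le_lintegral _ _).trans_lt hEfin.lt_top).ne
  have hlim : Tendsto (fun ε : ℝ => ((((∫⁻ y in A ε, ‖∇ φ y‖ₑ ^ 2).toReal +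
      M * ε ^ 2 * (∫⁻ y, ‖φ y‖ₑ ^ 2).toReal) /
      (choquardEnergy μ (A ε) φ).toReal ^ (1 / critExp N μ) : ℝ) : EReal)) (𝓝[>] 0)
      (𝓝 (((∫⁻ y in H, ‖∇ φ y‖ₑ ^ 2).toReal /
        (choquardEnergy μ H φ).toReal ^ (1 / critExp N μ) : ℝ) : EReal)) := by
    refine (continuous_coe_real_ereal.tendsto _).comp (Tendsto.div ?_ ?_ ?_)
    · have h1 := (ENNReal.tendsto_toReal hEt).comp hE
      have h2 : Tendsto (fun ε : ℝ => M * ε ^ 2 * (∫⁻ y, ‖φ y‖ₑ ^ 2).toReal) (𝓝[>] 0) (𝓝 0) := by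
        have hcont : Continuous fun ε : ℝ => M * ε ^ 2 * (∫⁻ y, ‖φ y‖ₑ ^ 2).toReal := by fun_prop
        exact (hcont.tendsto' 0 0 (by simp)).mono_left nhdsWithin_le_nhds
      simpa using h1.add h2
    · exact ((ENNReal.tendsto_toReal hHt).comp hD).rpow_const (Or.inr (by positivity))
    · exact (Real.rpow_pos_of_pos (ENNReal.toReal_pos hpos.ne' hHt) _).ne'
  refine ge_of_tendsto hlim ?_
  filter_upwards [hD.eventually (lt_mem_nhds hpos), self_mem_nhdsWithin] with ε h1 h2
  have hAε : A ε = (blowUp x₀ o L ε (ne_of_gt h2)).symm ⁻¹' Ω := by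
    ext y
    rw [mem_preimage, blowUp_symm_apply]
    rfl
  rw [hAε] at h1 ⊢
  exact neumannConstant_le_blowUp hN hμN hΩ.measurableSet hM hφ hc hfin x₀ o L h2 h1

/-! ### Positivity of the Dirichlet constant and conclusion -/

theorem IsTestFunction.choquardEnergy_eq_univ {N : ℕ} {μ : ℝ} (hp : 0 < critExp N μ)
    {Ω : Set (Space N)} (hΩ : MeasurableSet Ω) {φ : Space N → ℝ} (h : IsTestFunction Ω φ) :
    choquardEnergy μ Ω φ = choquardEnergy μ Set.univ φ := by
  have h0 : ∀ x, x ∉ Ω → φ x = 0 := fun x hx =>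
    image_eq_zero_of_notMem_tsupport fun h' => hx (h.tsupport_subset h')
  unfold choquardEnergy
  rw [← lintegral_indicator hΩ, Measure.restrict_univ]
  refine lintegral_congr fun x => ?_
  by_cases hx : x ∈ Ω
  · rw [Set.indicator_of_mem hx, ← lintegral_indicator hΩ]
    refine lintegral_congr fun y => ?_
    by_cases hy : y ∈ Ω
    · rw [Set.indicator_of_mem hy]
    · rw [Set.indicator_of_notMem hy, h0 y hy]
      simp [Real.zero_rpow hp.ne']
  · rw [Set.indicator_of_notMem hx, h0 x hx]
    simp [Real.zero_rpow hp.ne']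

theorem IsTestFunction.dirichlet_eq {N : ℕ} {Ω : Set (Space N)} (hΩ : MeasurableSet Ω)
    {φ : Space N → ℝ} (h : IsTestFunction Ω φ) :
    ∫⁻ x in Ω, ‖∇ φ x‖ₑ ^ 2 = ∫⁻ x, ‖∇ φ x‖ₑ ^ 2 := by
  have h0 : ∀ x, x ∉ Ω → fderiv ℝ φ x = 0 := fun x hx =>
    image_eq_zero_of_notMem_tsupport fun h' => hx (h.tsupport_subset (tsupport_fderiv_subset ℝ h'))
  rw [← lintegral_indicator hΩ]
  refine lintegral_congr fun x => ?_
  by_cases hx : x ∈ Ω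
  · rw [Set.indicator_of_mem hx]
  · have h1 : ‖∇ φ x‖ₑ = 0 := by
      rw [← ofReal_norm, norm_gradient, h0 x hx, norm_zero, ENNReal.ofReal_zero]
    rw [Set.indicator_of_notMem hx, h1, zero_pow two_ne_zero]

theorem lintegral_enorm_sq_ne_top {N : ℕ} {Ω : Set (Space N)} {G : Space N → Space N}
    (hG : MemLp G 2 (volume.restrict Ω)) : ∫⁻ x in Ω, ‖G x‖ₑ ^ 2 ≠ ⊤ := by
  rw [lintegral_enorm_sq_eq]
  exact ENNReal.rpow_ne_top_of_nonneg (by norm_num) hG.2.ne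

theorem choquardEnergy_ne_zero {N : ℕ} {μ : ℝ} {Ω : Set (Space N)} (hΩ : IsOpen Ω)
    {f : Space N → ℝ} (hf : Continuous f) {x₀ : Space N} (hx₀ : x₀ ∈ Ω) (hfx : f x₀ ≠ 0)
    [Nontrivial (Space N)] : choquardEnergy μ Ω f ≠ 0 := by
  intro h0
  have hfm := hf.measurable
  have hVo : IsOpen (Ω ∩ {x | f x ≠ 0}) := hΩ.inter (hf.isOpen_preimage _ isOpen_ne)
  have hV : 0 < volume (Ω ∩ {x | f x ≠ 0}) := hVo.measure_pos _ ⟨x₀, hx₀, hfx⟩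
  have hjm : Measurable fun q : Space N × Space N =>
      ENNReal.ofReal (|f q.1| ^ critExp N μ * |f q.2| ^ critExp N μ / ‖q.1 - q.2‖ ^ μ) := by
    fun_prop
  unfold choquardEnergy at h0
  rw [lintegral_eq_zero_iff hjm.lintegral_prod_right', EventuallyEq,
    ae_restrict_iff' hΩ.measurableSet] at h0
  obtain ⟨x, hx, hx'⟩ := Measure.exists_mem_of_measure_ne_zero_of_ae hV.ne'
    (ae_restrict_of_ae h0)
  have h1 := hx' hx.1
  simp only [Pi.zero_apply] at h1
  rw [lintegral_eq_zero_iff (by fun_prop), EventuallyEq, ae_restrict_iff' hΩ.measurableSet] at h1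
  refine hV.ne' ?_
  rw [measure_eq_zero_iff_ae_notMem]
  filter_upwards [h1, Measure.ae_ne volume x] with y hy hyx hyV
  have h2 := hy hyV.1
  rw [Pi.zero_apply, ENNReal.ofReal_eq_zero] at h2
  have h3 : 0 < ‖x - y‖ := norm_pos_iff.mpr (sub_ne_zero.mpr hyx.symm)
  have h4 : 0 < |f x| := abs_pos.mpr hx.2
  have h5 : 0 < |f y| := abs_pos.mpr hyV.2
  have h6 : 0 < |f x| ^ critExp N μ * |f y| ^ critExp N μ / ‖x - y‖ ^ μ := by positivity
  linarith

/-- Some test function on a non-empty open set has Choquard energy one. -/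
theorem exists_isTestFunction_choquardEnergy_eq_one {N : ℕ} (hN : 4 ≤ N) {μ : ℝ} (hμ0 : 0 < μ)
    (hμN : μ < N) {Ω : Set (Space N)} (hΩ : IsOpen Ω) (hne : Ω.Nonempty) :
    ∃ φ, IsTestFunction Ω φ ∧ choquardEnergy μ Ω φ = 1 := by
  have hp := critExp_pos hN hμN
  have : Nonempty (Fin N) := ⟨⟨0, by omega⟩⟩
  obtain ⟨x, hx⟩ := hne
  obtain ⟨f, hfs, hfc, hf, -, hfx⟩ := exists_contDiff_tsupport_subset (n := ⊤) (hΩ.mem_nhds hx)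
  have hft : IsTestFunction Ω f := ⟨hf, hfc, hfs⟩
  obtain ⟨C, hC, h⟩ := exists_choquardEnergy_le hN hμ0 hμN
  have hfin : choquardEnergy μ Ω f ≠ ⊤ := by
    rw [hft.choquardEnergy_eq_univ hp hΩ.measurableSet]
    refine ((h f hf hfc).trans_lt (ENNReal.mul_lt_top hC.lt_top ?_)).ne
    refine ENNReal.rpow_lt_top_of_nonneg hp.le ?_
    rw [← hft.dirichlet_eq hΩ.measurableSet]
    exact lintegral_enorm_sq_ne_top hft.isH10.memLp_grad
  have hpos : choquardEnergy μ Ω f ≠ 0 :=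
    choquardEnergy_ne_zero hΩ hf.continuous hx (by rw [hfx]; exact one_ne_zero)
  set d := (choquardEnergy μ Ω f).toReal with hd
  have hd0 : 0 < d := ENNReal.toReal_pos hpos hfin
  set c : ℝ := d ^ (-(1 / (2 * critExp N μ))) with hc
  have hc0 : 0 < c := by positivity
  refine ⟨fun x => c * f x, ⟨contDiff_const.mul hf, hfc.mul_left,
    (tsupport_mul_subset_right (f := fun _ => c)).trans hfs⟩, ?_⟩
  have hscale : choquardEnergy μ Ω (fun x => c * f x) =
      ENNReal.ofReal (c ^ (2 * critExp N μ)) * choquardEnergy μ Ω f := by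
    unfold choquardEnergy
    rw [← lintegral_const_mul' _ _ ENNReal.ofReal_ne_top]
    refine lintegral_congr fun x => ?_
    rw [← lintegral_const_mul' _ _ ENNReal.ofReal_ne_top]
    refine lintegral_congr fun y => ?_
    rw [← ENNReal.ofReal_mul (by positivity), abs_mul, abs_mul, abs_of_pos hc0,
      Real.mul_rpow hc0.le (abs_nonneg _), Real.mul_rpow hc0.le (abs_nonneg _), two_mul,
      Real.rpow_add hc0]
    congr 1; ring
  rw [hscale, hc, ← Real.rpow_mul hd0.le, show -(1 / (2 * critExp N μ)) * (2 * critExp N μ) = -1 by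
    field_simp, ← ENNReal.ofReal_toReal hfin, ← hd, ← ENNReal.ofReal_mul (by positivity),
    Real.rpow_neg_one, inv_mul_cancel₀ hd0.ne', ENNReal.ofReal_one]

/-- If the energies of test functions satisfy `D ≤ B ^ (-p) E ^ p`, where `p = 2*_μ`, then `B` is a
lower bound for `S_H`. -/
theorem le_bestConstant {N : ℕ} (hN : 4 ≤ N) {μ : ℝ} (hμ0 : 0 < μ) (hμN : μ < N)
    {Ω : Set (Space N)} (hΩ : IsOpen Ω) (hne : Ω.Nonempty) {B : ℝ} (hB : 0 < B)
    (h : ∀ φ, IsTestFunction Ω φ → choquardEnergy μ Ω φ ≤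
      ENNReal.ofReal (B ^ (-critExp N μ)) * (∫⁻ x in Ω, ‖∇ φ x‖ₑ ^ 2) ^ critExp N μ) :
    B ≤ bestConstant μ Ω := by
  have hp := critExp_pos hN hμN
  obtain ⟨φ, hφ, hφ1⟩ := exists_isTestFunction_choquardEnergy_eq_one hN hμ0 hμN hΩ hne
  refine le_csInf ⟨_, φ, ∇ φ, hφ.isH10, hφ1, rfl⟩ ?_
  rintro s ⟨u, G, hu, hu1, rfl⟩
  have h1 := choquardEnergy_le_of_isH10 ENNReal.ofReal_ne_top hp hp h hu
  have ht := lintegral_enorm_sq_ne_top hu.memLp_grad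
  rw [integral_norm_sq_eq hu.memLp_grad.1]
  set E := (∫⁻ x in Ω, ‖G x‖ₑ ^ 2).toReal with hE
  have hE0 : 0 ≤ E := ENNReal.toReal_nonneg
  rw [hu1, ← ENNReal.ofReal_toReal ht, ENNReal.ofReal_rpow_of_nonneg hE0 hp.le,
    ← ENNReal.ofReal_mul (by positivity), ENNReal.one_le_ofReal, Real.rpow_neg hB.le,
    inv_mul_eq_div, one_le_div (by positivity)] at h1
  exact (Real.rpow_le_rpow_iff hB.le hE0 hp).mp h1

theorem bestConstant_pos {N : ℕ} (hN : 4 ≤ N) {μ : ℝ} (hμ0 : 0 < μ) (hμN : μ < N)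
    {Ω : Set (Space N)} (hΩ : IsOpen Ω) (hne : Ω.Nonempty) : 0 < bestConstant μ Ω := by
  have hp := critExp_pos hN hμN
  obtain ⟨C, hC, h⟩ := exists_choquardEnergy_le hN hμ0 hμN
  set c := C.toReal + 1 with hc
  have hc0 : 0 < c := by positivity
  refine lt_of_lt_of_le (Real.rpow_pos_of_pos hc0 (-(1 / critExp N μ)))
    (le_bestConstant hN hμ0 hμN hΩ hne (by positivity) fun φ hφ => ?_)
  rw [hφ.choquardEnergy_eq_univ hp hΩ.measurableSet, hφ.dirichlet_eq hΩ.measurableSet,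
    ← Real.rpow_mul hc0.le, show -(1 / critExp N μ) * -critExp N μ = 1 by field_simp,
    Real.rpow_one]
  refine (h φ hφ.contDiff hφ.hasCompactSupport).trans (mul_le_mul_left ?_ _)
  rw [← ENNReal.ofReal_toReal hC]
  exact ENNReal.ofReal_le_ofReal (by linarith)

/-- The Neumann constant of a continuous potential on a bounded smooth domain lies strictly below
`S_H / 2 ^ ((2*_μ - 2) / 2*_μ)`. If it did not, concentration at a boundary point would bound the
quotient of every half of a test function from below, and the gap between a function and a
well-chosen half of it would improve the constant `S_H` in its own defining inequality. -/
theorem neumannConstant_lt {N : ℕ} (hN : 4 ≤ N) {μ : ℝ} (hμ0 : 0 < μ) (hμN : μ < N)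
    {Ω : Set (Space N)} (hΩ : IsBoundedSmoothDomain Ω) {a : Space N → ℝ}
    (ha : ContinuousOn a (closure Ω)) {x₀ : Space N} (hx₀ : x₀ ∈ frontier Ω) :
    neumannConstant μ Ω a <
      ((bestConstant μ Ω / (2 : ℝ) ^ ((critExp N μ - 2) / critExp N μ) : ℝ) : EReal) := by
  have hp := critExp_pos hN hμN
  have hS := bestConstant_pos hN hμ0 hμN hΩ.isOpen hΩ.isConnected.nonempty
  obtain ⟨T, ρ, R, hgraph⟩ := hΩ.smooth_boundary x₀ hx₀
  obtain ⟨θ, hθ, hgap⟩ := exists_halfSpace_gap hN hμ0 hμN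
  obtain ⟨C, hC, hCbound⟩ := exists_choquardEnergy_le hN hμ0 hμN
  obtain ⟨M, hM⟩ := hΩ.isBounded.isCompact_closure.exists_bound_of_continuousOn ha
  by_contra! hcon
  set p := critExp N μ with hp_def
  set S := bestConstant μ Ω with hS_def
  have hθp : 1 < θ ^ (1 / p) := Real.one_lt_rpow hθ (by positivity)
  refine absurd (le_bestConstant hN hμ0 hμN hΩ.isOpen hΩ.isConnected.nonempty
    (B := S * θ ^ (1 / p)) (by positivity) fun φ hφ => ?_) (not_le.mpr (lt_mul_of_one_lt_right hS hθp))
  rw [hφ.choquardEnergy_eq_univ hp hΩ.isOpen.measurableSet, hφ.dirichlet_eq hΩ.isOpen.measurableSet]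
  have hEt : ∫⁻ x, ‖∇ φ x‖ₑ ^ 2 ≠ ⊤ := by
    rw [← hφ.dirichlet_eq hΩ.isOpen.measurableSet]
    exact lintegral_enorm_sq_ne_top hφ.isH10.memLp_grad
  have hDt : choquardEnergy μ Set.univ φ ≠ ⊤ :=
    ((hCbound φ hφ.contDiff hφ.hasCompactSupport).trans_lt (ENNReal.mul_lt_top hC.lt_top
      (ENNReal.rpow_lt_top_of_nonneg hp.le hEt))).ne
  rcases eq_or_ne (choquardEnergy μ Set.univ φ) 0 with hD0 | hD0
  · rw [hD0]; exact zero_le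
  obtain ⟨o, w, hw, hgapD, hgapE⟩ := hgap φ hφ.contDiff.continuous hφ.hasCompactSupport hDt
    fun x => ‖∇ φ x‖ₑ ^ 2
  set H : Set (Space N) := {x | 0 < inner ℝ w (x - o)} with hH
  have hHpos : 0 < choquardEnergy μ H φ := by
    refine pos_iff_ne_zero.mpr fun h0 => ?_
    rw [h0, mul_zero, nonpos_iff_eq_zero, mul_eq_zero, ENNReal.ofReal_eq_zero] at hgapD
    rcases hgapD with h | h
    · linarith
    · exact hD0 h
  have hHt : choquardEnergy μ H φ ≠ ⊤ :=
    ((choquardEnergy_mono μ (Set.subset_univ H) φ).trans_lt hDt.lt_top).ne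
  have hEHt : ∫⁻ x in H, ‖∇ φ x‖ₑ ^ 2 ≠ ⊤ :=
    ((setLIntegral_le_lintegral _ _).trans_lt hEt.lt_top).ne
  have hquot := EReal.coe_le_coe_iff.mp (hcon.trans (neumannConstant_le_halfSpace hN hμN hΩ.isOpen
    (fun x hx => hM x (subset_closure hx)) hgraph hφ.contDiff hφ.hasCompactSupport hDt o hw hHpos))
  set e := (∫⁻ x, ‖∇ φ x‖ₑ ^ 2).toReal with he
  set eH := (∫⁻ x in H, ‖∇ φ x‖ₑ ^ 2).toReal with heH
  set d := (choquardEnergy μ Set.univ φ).toReal with hd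
  set dH := (choquardEnergy μ H φ).toReal with hdH
  have hd0 : 0 < d := ENNReal.toReal_pos hD0 hDt
  have hdH0 : 0 < dH := ENNReal.toReal_pos hHpos.ne' hHt
  have he0 : 0 ≤ e := ENNReal.toReal_nonneg
  have h1 : θ * d ≤ 4 * dH := by
    have := ENNReal.toReal_mono (ENNReal.mul_ne_top (by simp) hHt) hgapD
    rwa [ENNReal.toReal_mul, ENNReal.toReal_mul, ENNReal.toReal_ofReal (by linarith)] at this
  have h2 : 2 * eH ≤ e := by
    have := ENNReal.toReal_mono hEt hgapE
    rwa [ENNReal.toReal_mul] at this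
  have h3 : (θ * d) ^ (1 / p) ≤ 2 ^ (2 / p) * dH ^ (1 / p) := by
    refine (Real.rpow_le_rpow (by positivity) h1 (by positivity)).trans (le_of_eq ?_)
    rw [Real.mul_rpow (by norm_num) hdH0.le, show (4 : ℝ) = 2 ^ (2 : ℝ) by norm_num,
      ← Real.rpow_mul (by norm_num)]
    congr 2; ring
  have h4 : S * dH ^ (1 / p) ≤ eH * 2 ^ ((p - 2) / p) :=
    (div_le_div_iff₀ (by positivity) (by positivity)).mp hquot
  have h5 : (2 : ℝ) ^ ((p - 2) / p) * 2 ^ (2 / p) = 2 := by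
    rw [← Real.rpow_add (by norm_num), show (p - 2) / p + 2 / p = 1 by field_simp; ring,
      Real.rpow_one]
  have h6 : S * θ ^ (1 / p) * d ^ (1 / p) ≤ e := by
    calc S * θ ^ (1 / p) * d ^ (1 / p) = S * (θ * d) ^ (1 / p) := by
          rw [Real.mul_rpow (by linarith) hd0.le, mul_assoc]
      _ ≤ S * (2 ^ (2 / p) * dH ^ (1 / p)) := by gcongr
      _ = S * dH ^ (1 / p) * 2 ^ (2 / p) := by ring
      _ ≤ eH * 2 ^ ((p - 2) / p) * 2 ^ (2 / p) := by gcongr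
      _ = 2 * eH := by rw [mul_assoc, h5, mul_comm]
      _ ≤ e := h2
  have h7 : d ≤ (S * θ ^ (1 / p)) ^ (-p) * e ^ p := by
    have := Real.rpow_le_rpow (by positivity) h6 hp.le
    rw [Real.mul_rpow (by positivity) (by positivity), ← Real.rpow_mul hd0.le,
      one_div_mul_cancel hp.ne', Real.rpow_one] at this
    rw [Real.rpow_neg (by positivity), inv_mul_eq_div, le_div_iff₀ (by positivity), mul_comm]
    exact this
  rw [← ENNReal.ofReal_toReal hDt, ← ENNReal.ofReal_toReal hEt,
    ENNReal.ofReal_rpow_of_nonneg he0 hp.le, ← ENNReal.ofReal_mul (by positivity)]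
  exact ENNReal.ofReal_le_ofReal h7

end NeumannChoquard

theorem lemma3p3 (N : ℕ) (hN : 4 ≤ N) (μ : ℝ) (hμ0 : 0 < μ) (hμN : μ < N)
    (Ω : Set (NeumannChoquard.Space N)) (hΩ : NeumannChoquard.IsBoundedSmoothDomain Ω)
    (α : NeumannChoquard.Space N → ℝ) (hα : ContinuousOn α (closure Ω))
    (x₀ : NeumannChoquard.Space N) (hx₀ : x₀ ∈ frontier Ω) (hαx₀ : 0 < α x₀)
    (k : ℝ) (hk : (6 * N - μ) / (2 * N - μ) < k)
    (hflat : NeumannChoquard.IsFlatOfOrder Ω x₀ k)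
    (lam : ℝ) (hlam : 0 < lam) :
    NeumannChoquard.neumannConstant μ Ω (fun x => lam * α x) <
      ((NeumannChoquard.bestConstant μ Ω /
        (2 : ℝ) ^ ((NeumannChoquard.critExp N μ - 2) / NeumannChoquard.critExp N μ) : ℝ) :
          EReal) :=
  NeumannChoquard.neumannConstant_lt hN hμ0 hμN hΩ (hα.const_smul lam) hx₀
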